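/- Let $d\in\{1,2,3\}$, $k>0$, $T>0$, $H=U=L^2((0,1)^d,\mathbb R)$ and $\beta=d/5$. For $i\in\{1,2,\dots\}^d$ put $e_i(x)=2^{d/2}\prod_{j=1}^d\sin(i_j\pi x_j)$ and $\lambda_i=k\pi^2\sum_{j=1}^d i_j^2$ (the eigenfunctions and eigenvalues of $-A$, where $A=k\Delta$ with Dirichlet boundary conditions), and let $V_\beta=D((-A)^\beta)=\{v\in H:\sum_i|\lambda_i^\beta\langle e_i,v\rangle_H|^2<\infty\}$ with $\|v\|_{V_\beta}=\|(-A)^\beta v\|_H$, $(-A)^\beta v=\sum_i\lambda_i^\beta\langle e_i,v\rangle_H\,e_i$. Let $Q$ be a bounded, symmetric, nonnegative operator on $U$ with finite trace, and let $(\eta_j)_{j\in\mathcal J}$, with $\mathcal J$ countable, be an orthonormal basis of $U$ with $Q\eta_j=\mu_j\eta_j$. Let $U_0=Q^{1/2}(U)$ with $\langle v,w\rangle_{U_0}=\langle Q^{-1/2}v,Q^{-1/2}w\rangle_U$, where $Q^{-1/2}$ is the pseudo inverse of $Q^{1/2}$. Assume that for some $c>0$ and $\rho\in(0,1)$ the $\eta_j$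 are continuous on $(0,1)^d$ and $$\sup_{j}\ \sup_{x\in(0,1)^d}|\eta_j(x)|\le c,\qquad \sum_{j}\mu_j\Big(\sup_{x}|\eta_j(x)|+\sup_{x\ne y}\frac{|\eta_j(x)-\eta_j(y)|}{\|x-y\|^\rho}\Big)^2\le c .$$ Let $g:(0,1)^d\times\mathbb R\to\mathbb R$ be twice continuously differentiable such that for all $x\in(0,1)^d$, $y\in\mathbb R$ $$|g(x,0)|\le c,\qquad |\partial_y g(x,y)|\le c,\qquad |\partial_y^2 g(x,y)|\le c,\qquad \|\partial_x g(x,y)\|_{L(\mathbb R^d;\mathbb R)}\le c .$$ For $v\in V_\beta$, $h\in(0,T]$ and $u,\tilde u\in U_0$ put $$\big(GG(v,h)(u,\tilde u)\big)(x)=\tfrac1{\sqrt h}\Big(g\big(x,v(x)+\sqrt h\,g(x,v(x))\big)-g(x,v(x))\Big)u(x)\tilde u(x),$$ $$\big(G'(v)G(v)(u,\tilde u)\big)(x)=\partial_y g(x,v(x))\,g(x,v(x))\,u(x)\tilde u(x),\qquad GG_1(v,h)=GG(v,h)-G'(v)G(v).$$ Then $GG(v,h)$, $G'(v)G(v)$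 and $GG_1(v,h)$ are well-defined bilinear Hilbert--Schmidt operators in $HS^{(2)}(U_0,H)$, and there is a constant $C_0>0$, independent of $h$, $v$ and $w$, such that for all $h\in(0,T]$ and all $v,w\in V_\beta$ $$\|GG(v,h)-GG(w,h)\|^2_{HS^{(2)}(U_0,H)}\le\frac{C_0}{h}\,\|v-w\|_H^2,\qquad \|GG_1(v,h)\|^2_{HS^{(2)}(U_0,H)}\le C_0\,h\,\big(1+\|v\|_{V_\beta}^4\big).$$ Here $\|B\|^2_{HS^{(2)}(U_0,H)}=\sum_{i,j}\|B(\psi_i,\psi_j)\|_H^2$ for any orthonormal basis $(\psi_i)$ of $U_0$. -/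

import Mathlib

open MeasureTheory Set
open scoped ENNReal

noncomputable section

namespace ParabolicSPDE

/-! ### The square root `Q^{1/2}` and the Hilbert space `U₀ = Q^{1/2}(U)` -/

section CameronMartin

variable {U : Type*} [NormedAddCommGroup U] [InnerProductSpace ℝ U]

open Classical in
/-- The square root `Q^{1/2}` of a nonnegative symmetric operator `Q`: the nonnegative symmetric
bounded operator `S` with `S ∘ S = Q` (it exists and is unique for nonnegative symmetric `Q` on a
Hilbert space; for other `Q` the value is irrelevant). -/
def sqrtOp (Q : U →L[ℝ] U) : U →L[ℝ] U :=
  if h : ∃ S : U →L[ℝ] U, S.IsPositive ∧ S ∘L S = Q then h.choose else 0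

/-- The vector space `U₀ = Q^{1/2}(U)`. It does not carry the norm of `U`. -/
def U0 (Q : U →L[ℝ] U) : Type _ := LinearMap.range (sqrtOp Q).toLinearMap

instance (Q : U →L[ℝ] U) : AddCommGroup (U0 Q) :=
  inferInstanceAs (AddCommGroup (LinearMap.range (sqrtOp Q).toLinearMap))

instance (Q : U →L[ℝ] U) : Module ℝ (U0 Q) :=
  inferInstanceAs (Module ℝ (LinearMap.range (sqrtOp Q).toLinearMap))

/-- The inclusion `U₀ ⊆ U`. -/
def U0.incl (Q : U →L[ℝ] U) : U0 Q →ₗ[ℝ] U :=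
  (LinearMap.range (sqrtOp Q).toLinearMap).subtype

variable [CompleteSpace U]

theorem exists_pinv (Q : U →L[ℝ] U) (y : U0 Q) :
    ∃ x : U, x ∈ (LinearMap.ker (sqrtOp Q).toLinearMap)ᗮ ∧ sqrtOp Q x = U0.incl Q y := by
  obtain ⟨y, x, rfl⟩ := y
  have hc : IsClosed ((LinearMap.ker (sqrtOp Q).toLinearMap : Submodule ℝ U) : Set U) :=
    (sqrtOp Q).isClosed_ker
  have : CompleteSpace (LinearMap.ker (sqrtOp Q).toLinearMap) := hc.completeSpace_coe
  obtain ⟨a, ha, b, hb, hab⟩ :=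
    (LinearMap.ker (sqrtOp Q).toLinearMap).exists_add_mem_mem_orthogonal x
  refine ⟨b, hb, ?_⟩
  have ha' : sqrtOp Q a = 0 := ha
  change sqrtOp Q b = sqrtOp Q x
  rw [hab, map_add, ha', zero_add]

theorem pinv_unique (Q : U →L[ℝ] U) {x x' : U}
    (hx : x ∈ (LinearMap.ker (sqrtOp Q).toLinearMap)ᗮ)
    (hx' : x' ∈ (LinearMap.ker (sqrtOp Q).toLinearMap)ᗮ)
    (h : sqrtOp Q x = sqrtOp Q x') : x = x' := by
  have h1 : x - x' ∈ LinearMap.ker (sqrtOp Q).toLinearMap := by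
    change sqrtOp Q (x - x') = 0
    rw [map_sub, h, sub_self]
  have h2 := (Submodule.sub_mem _ hx hx') (x - x') h1
  exact sub_eq_zero.mp (inner_self_eq_zero.mp h2)

/-- The pseudo inverse `Q^{-1/2} : U₀ → U` of `Q^{1/2}`: it sends `y` to the unique
`x ∈ (ker Q^{1/2})ᗮ` with `Q^{1/2} x = y`. -/
def pinv (Q : U →L[ℝ] U) : U0 Q →ₗ[ℝ] U where
  toFun y := (exists_pinv Q y).choose
  map_add' y z := by
    refine pinv_unique Q (exists_pinv Q (y + z)).choose_spec.1
      (Submodule.add_mem _ (exists_pinv Q y).choose_spec.1 (exists_pinv Q z).choose_spec.1) ?_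
    rw [(exists_pinv Q (y + z)).choose_spec.2, map_add, map_add,
      (exists_pinv Q y).choose_spec.2, (exists_pinv Q z).choose_spec.2]
  map_smul' r y := by
    refine pinv_unique Q (exists_pinv Q (r • y)).choose_spec.1
      (Submodule.smul_mem _ _ (exists_pinv Q y).choose_spec.1) ?_
    rw [(exists_pinv Q (r • y)).choose_spec.2]
    simp [(exists_pinv Q y).choose_spec.2]

theorem pinv_mem (Q : U →L[ℝ] U) (y : U0 Q) :
    pinv Q y ∈ (LinearMap.ker (sqrtOp Q).toLinearMap)ᗮ :=
  (exists_pinv Q y).choose_spec.1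

theorem sqrtOp_pinv (Q : U →L[ℝ] U) (y : U0 Q) : sqrtOp Q (pinv Q y) = U0.incl Q y :=
  (exists_pinv Q y).choose_spec.2

theorem pinv_injective (Q : U →L[ℝ] U) : Function.Injective (pinv Q) := by
  intro y z h
  apply Subtype.ext
  change U0.incl Q y = U0.incl Q z
  rw [← sqrtOp_pinv, ← sqrtOp_pinv, h]

/-- The norm `‖v‖_{U₀} = ‖Q^{-1/2} v‖_U`. -/
instance (Q : U →L[ℝ] U) : NormedAddCommGroup (U0 Q) :=
  NormedAddCommGroup.induced (U0 Q) U (pinv Q) (pinv_injective Q)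

/-- The inner product `⟨v, w⟩_{U₀} = ⟨Q^{-1/2} v, Q^{-1/2} w⟩_U`. -/
instance (Q : U →L[ℝ] U) : InnerProductSpace ℝ (U0 Q) where
  norm_smul_le r v := by
    change ‖pinv Q (r • v)‖ ≤ ‖r‖ * ‖pinv Q v‖
    rw [map_smul, norm_smul]
  inner v w := inner ℝ (pinv Q v) (pinv Q w)
  norm_sq_eq_re_inner v := norm_sq_eq_re_inner (𝕜 := ℝ) (pinv Q v)
  conj_inner_symm v w := inner_conj_symm (𝕜 := ℝ) (pinv Q v) (pinv Q w)
  add_left u v w := by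
    rw [map_add, inner_add_left]
  smul_left v w r := by
    rw [map_smul, inner_smul_left]

theorem U0.inner_eq (Q : U →L[ℝ] U) (v w : U0 Q) :
    inner ℝ v w = inner ℝ (pinv Q v) (pinv Q w) := rfl

theorem U0.norm_eq (Q : U →L[ℝ] U) (v : U0 Q) : ‖v‖ = ‖pinv Q v‖ := rfl

/-- `U₀` is a Hilbert space: `Q^{-1/2}` is an isometry onto the closed subspace
`(ker Q^{1/2})ᗮ` of `U`. -/
instance (Q : U →L[ℝ] U) : CompleteSpace (U0 Q) := by
  have hiso : Isometry (pinv Q) := AddMonoidHomClass.isometry_of_norm _ fun v => rfl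
  have hr : Set.range (pinv Q) = ((LinearMap.ker (sqrtOp Q).toLinearMap)ᗮ : Submodule ℝ U) := by
    ext x
    constructor
    · rintro ⟨y, rfl⟩
      exact pinv_mem Q y
    · intro hx
      exact ⟨⟨sqrtOp Q x, x, rfl⟩, pinv_unique Q (pinv_mem Q _) hx (sqrtOp_pinv Q _)⟩
  rw [completeSpace_iff_isComplete_range hiso.isUniformInducing, hr]
  exact (Submodule.isClosed_orthogonal _).isComplete

end CameronMartin

/-! ### Bilinear Hilbert–Schmidt operators -/

section HilbertSchmidt

variable {E F : Type*} [NormedAddCommGroup E] [InnerProductSpace ℝ E]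
  [NormedAddCommGroup F] [InnerProductSpace ℝ F]

/-- The squared norm `‖B‖²_{HS^{(2)}(E,F)} = ∑_{i,j} ‖B(ψ_i, ψ_j)‖²`, where `ψ` is an orthonormal
basis of `E`. For bounded bilinear `B` the sum does not depend on the basis; the supremum over all
orthonormal bases makes the definition free of a choice of basis. -/
def hs2NormSq (B : E → E → F) : ℝ≥0∞ :=
  ⨆ (s : Set E) (ψ : HilbertBasis s ℝ E), ∑' i, ∑' j, ‖B (ψ i) (ψ j)‖ₑ ^ 2

/-- `B ∈ HS^{(2)}(E, F)`: `B` is bounded, bilinear and of finite Hilbert–Schmidt norm. -/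
def IsHS2 (B : E → E → F) : Prop :=
  (∃ B' : E →L[ℝ] E →L[ℝ] F, ∀ u w, B' u w = B u w) ∧ hs2NormSq B < ∞

end HilbertSchmidt

/-! ### The concrete spaces on the cube `(0,1)^d` -/

/-- The open cube `(0,1)^d`. -/
def cube (d : ℕ) : Set (EuclideanSpace ℝ (Fin d)) := {x | ∀ i, x i ∈ Ioo (0 : ℝ) 1}

/-- Lebesgue measure on the open cube `(0,1)^d`. -/
abbrev cubeMeasure (d : ℕ) : Measure (EuclideanSpace ℝ (Fin d)) := volume.restrict (cube d)

/-- `H = U = L²((0,1)^d, ℝ)`. -/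
abbrev HSp (d : ℕ) : Type := Lp ℝ 2 (cubeMeasure d)

theorem measurableSet_cube (d : ℕ) : MeasurableSet (cube d) := by
  have : cube d = ⋂ i, (fun x : EuclideanSpace ℝ (Fin d) => x i) ⁻¹' Ioo (0 : ℝ) 1 := by
    ext x; simp [cube]
  rw [this]
  exact MeasurableSet.iInter fun i =>
    (by fun_prop : Measurable fun x : EuclideanSpace ℝ (Fin d) => x i) measurableSet_Ioo

instance (d : ℕ) : IsFiniteMeasure (cubeMeasure d) := by
  refine ⟨?_⟩
  rw [Measure.restrict_apply_univ]
  refine Bornology.IsBounded.measure_lt_top ?_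
  refine (Metric.isBounded_closedBall (x := (0 : EuclideanSpace ℝ (Fin d)))
    (r := Real.sqrt d)).subset fun x hx => ?_
  rw [mem_closedBall_zero_iff, EuclideanSpace.norm_eq]
  refine Real.sqrt_le_sqrt ?_
  calc ∑ i, ‖x i‖ ^ 2 ≤ ∑ _i : Fin d, (1 : ℝ) := by
        refine Finset.sum_le_sum fun i _ => ?_
        have := hx i
        rw [Real.norm_eq_abs, sq_abs]
        nlinarith [this.1, this.2]
    _ = d := by simp

/-- `‖φ‖_{C((0,1)^d)} = sup_{x ∈ (0,1)^d} |φ(x)|`, as an extended nonnegative real. -/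
def cNorm (d : ℕ) (φ : EuclideanSpace ℝ (Fin d) → ℝ) : ℝ≥0∞ :=
  ⨆ x ∈ cube d, ‖φ x‖ₑ

/-- `‖φ‖_{C^ρ((0,1)^d)} = sup |φ(x)| + sup_{x ≠ y} |φ(x) - φ(y)| / ‖x - y‖^ρ`, as an extended
nonnegative real. -/
def holderNorm (d : ℕ) (ρ : ℝ) (φ : EuclideanSpace ℝ (Fin d) → ℝ) : ℝ≥0∞ :=
  cNorm d φ + ⨆ x ∈ cube d, ⨆ y ∈ cube d, ⨆ _ : x ≠ y,
    ENNReal.ofReal (|φ x - φ y| / ‖x - y‖ ^ ρ)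

/-! ### The Dirichlet Laplacian and its fractional powers -/

/-- The eigenfunction `2^{d/2} ∏_j sin(i_j π x_j)`. -/
def eigFun {d : ℕ} (i : Fin d → ℕ+) (x : EuclideanSpace ℝ (Fin d)) : ℝ :=
  (2 : ℝ) ^ ((d : ℝ) / 2) * ∏ j, Real.sin ((i j : ℕ) * Real.pi * x j)

/-- The eigenvalue `λ_i = k π² ∑_j i_j²` of `-A = -kΔ` with Dirichlet boundary conditions. -/
def eigVal {d : ℕ} (k : ℝ) (i : Fin d → ℕ+) : ℝ :=
  k * Real.pi ^ 2 * ∑ j, ((i j : ℕ) : ℝ) ^ 2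

theorem memLp_eigFun {d : ℕ} (i : Fin d → ℕ+) : MemLp (eigFun i) 2 (cubeMeasure d) := by
  have hm : AEStronglyMeasurable (eigFun i) (cubeMeasure d) := by
    refine Continuous.aestronglyMeasurable ?_
    unfold eigFun
    fun_prop
  refine MemLp.of_bound hm ((2 : ℝ) ^ ((d : ℝ) / 2)) (Filter.Eventually.of_forall fun x => ?_)
  unfold eigFun
  rw [norm_mul, norm_prod, Real.norm_of_nonneg (by positivity)]
  refine mul_le_of_le_one_right (by positivity) ?_
  exact Finset.prod_le_one (fun _ _ => norm_nonneg _) fun j _ => Real.abs_sin_le_one _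

/-- `e_i` as an element of `H`. -/
def eig {d : ℕ} (i : Fin d → ℕ+) : HSp d := (memLp_eigFun i).toLp (eigFun i)

/-- `V_r = D((-A)^r) = {v ∈ H : ∑_i |λ_i^r ⟨e_i, v⟩|² < ∞}` for `A = kΔ`. -/
def VSet (d : ℕ) (k r : ℝ) : Set (HSp d) :=
  {v | Summable fun i : Fin d → ℕ+ => (eigVal k i ^ r * inner ℝ (eig i) v) ^ 2}

/-- `(-A)^r v = ∑_i λ_i^r ⟨e_i, v⟩ e_i` for `v ∈ V_r`. -/
def fracPow (d : ℕ) (k r : ℝ) (v : HSp d) : HSp d :=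
  ∑' i : Fin d → ℕ+, (eigVal k i ^ r * inner ℝ (eig i) v) • eig i

/-- `‖v‖_{V_r} = ‖(-A)^r v‖_H`. -/
def VNorm (d : ℕ) (k r : ℝ) (v : HSp d) : ℝ := ‖fracPow d k r v‖

/-! ### The bilinear operators -/

open Classical in
/-- The bilinear multiplication operator `(u, ũ) ↦ m · u · ũ` with values in `H = L²((0,1)^d)`;
the value is `0` for those `(u, ũ)` for which `m · u · ũ` is not square integrable. -/
def bilinMul {d : ℕ} (m : EuclideanSpace ℝ (Fin d) → ℝ) (u w : HSp d) : HSp d :=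
  if h : MemLp (fun x => m x * u x * w x) 2 (cubeMeasure d) then h.toLp _ else 0

/-- The function `x ↦ h^{-1/2} (g(x, v(x) + √h g(x, v(x))) - g(x, v(x)))`. -/
def fdCoeff {d : ℕ} (g : EuclideanSpace ℝ (Fin d) → ℝ → ℝ) (v : HSp d) (h : ℝ)
    (x : EuclideanSpace ℝ (Fin d)) : ℝ :=
  1 / Real.sqrt h * (g x (v x + Real.sqrt h * g x (v x)) - g x (v x))

/-- The function `x ↦ (∂g/∂y)(x, v(x)) g(x, v(x))`. -/
def milCoeff {d : ℕ} (g : EuclideanSpace ℝ (Fin d) → ℝ → ℝ) (v : HSp d)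
    (x : EuclideanSpace ℝ (Fin d)) : ℝ :=
  deriv (g x) (v x) * g x (v x)

/-- The finite-difference operator `GG(v,h) : U₀ × U₀ → H`. -/
def GG {d : ℕ} (Q : HSp d →L[ℝ] HSp d) (g : EuclideanSpace ℝ (Fin d) → ℝ → ℝ) (v : HSp d) (h : ℝ)
    (u w : U0 Q) : HSp d :=
  bilinMul (fdCoeff g v h) (U0.incl Q u) (U0.incl Q w)

/-- The operator `G'(v)G(v) : U₀ × U₀ → H`. -/
def GpG {d : ℕ} (Q : HSp d →L[ℝ] HSp d) (g : EuclideanSpace ℝ (Fin d) → ℝ → ℝ) (v : HSp d)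
    (u w : U0 Q) : HSp d :=
  bilinMul (milCoeff g v) (U0.incl Q u) (U0.incl Q w)

/-- The remainder `GG₁(v,h) = GG(v,h) - G'(v)G(v)`. -/
def GG1 {d : ℕ} (Q : HSp d →L[ℝ] HSp d) (g : EuclideanSpace ℝ (Fin d) → ℝ → ℝ) (v : HSp d) (h : ℝ)
    (u w : U0 Q) : HSp d :=
  GG Q g v h u w - GpG Q g v u w

end ParabolicSPDE

end

open ParabolicSPDE

/-! Point evaluation is bounded on U₀. Since Q^{1/2} η_j = √μ_j η_j, the vector K(x) = ∑_j √μ_j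
φ_j(x) η_j satisfies u(x) = ⟨Q^{-1/2}u, K(x)⟩ for almost every x, and the Hölder hypothesis gives
‖K(x)‖² ≤ c (`exists_evaluation_vector`). By Bessel's inequality ∑_i |ψ_i(x)|² ≤ c for finite
orthonormal families in U₀, so multiplication by m has squared Hilbert–Schmidt norm at most c² ∫ m²
(`hs2NormSq_le_of_ae_eq_mul`). Only L² bounds for the multipliers remain.

For GG(v,h) − GG(w,h), Lipschitz continuity of g in y bounds the multiplier by a constant times |v −
w|/√h. For GG₁(v,h), a Taylor expansion with increment √h g(x,v(x)) bounds it by √h c³ (1 + |v|)².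
Squaring produces the fourth moment of v, hence the need for the embedding V_{d/5} ⊆ L⁴
(`exists_lintegral_pow_four_le`).

The embedding is a Fourier argument. The square of an exponential sum has the self-convolution of
the coefficients as its coefficients, so Parseval turns the fourth moment into an ℓ² norm of a
convolution. Weighted Cauchy–Schwarz bounds it by W (∑ λ_i^{2β} a_i²)² with W ≥ ∑ λ_i^{-4β}, a sum
that is finite because 4β = 4d/5 > d/2. Passing from finite sums to v uses completeness of the sine
system (`eigBasis`), which rests on Stone–Weierstrass for the algebra generated by the cos(π x_l).
-/

noncomputable section

namespace ParabolicSPDE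

/-! ### The square root of a nonnegative operator with an orthonormal eigenbasis -/

section SquareRoot

variable {U : Type*} [NormedAddCommGroup U] [InnerProductSpace ℝ U] {J : Type*}

/-- The diagonal operator with bounded nonnegative entries in a Hilbert basis. -/
theorem exists_isPositive_diagonal (b : HilbertBasis J ℝ U) (s : J → ℝ) (hs : ∀ j, 0 ≤ s j) (C : ℝ)
    (hC : 0 ≤ C) (hsC : ∀ j, s j ≤ C) :
    ∃ S : U →L[ℝ] U, S.IsPositive ∧ ∀ x j, b.repr (S x) j = s j * b.repr x j := by
  have hle : ∀ (f : lp (fun _ : J => ℝ) 2) j, ‖s j * f j‖ ^ 2 ≤ C ^ 2 * ‖f j‖ ^ 2 := fun f j => by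
    rw [norm_mul, mul_pow, Real.norm_of_nonneg (hs j)]
    gcongr
    · exact hs j
    · exact hsC j
  have hsum : ∀ f : lp (fun _ : J => ℝ) 2, Summable fun j => ‖f j‖ ^ 2 := fun f => by
    simpa using (lp.memℓp f).summable (by norm_num)
  have hmem : ∀ f : lp (fun _ : J => ℝ) 2, Memℓp (fun j => s j * f j) 2 := fun f => by
    refine memℓp_gen ?_
    simpa using Summable.of_nonneg_of_le (fun j => by positivity) (hle f) ((hsum f).mul_left _)
  let D : lp (fun _ : J => ℝ) 2 →ₗ[ℝ] lp (fun _ : J => ℝ) 2 :=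
    { toFun := fun f => ⟨fun j => s j * f j, hmem f⟩
      map_add' := fun f g => by ext j; exact mul_add _ _ _
      map_smul' := fun r f => by ext j; exact mul_left_comm _ _ _ }
  have hD : ∀ f, ‖D f‖ ≤ C * ‖f‖ := fun f => by
    refine le_of_sq_le_sq ?_ (by positivity)
    have h1 := lp.norm_rpow_eq_tsum (p := 2) (by norm_num) (D f)
    have h2 := lp.norm_rpow_eq_tsum (p := 2) (by norm_num) f
    simp only [ENNReal.toReal_ofNat, Real.rpow_ofNat] at h1 h2
    rw [h1, mul_pow, h2, ← tsum_mul_left]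
    exact Summable.tsum_le_tsum (hle f) (hsum (D f)) ((hsum f).mul_left _)
  let e := b.repr.toLinearEquiv
  let S₀ : U →ₗ[ℝ] U := e.symm.toLinearMap ∘ₗ D ∘ₗ e.toLinearMap
  have hS₀ : ∀ x, ‖S₀ x‖ ≤ C * ‖x‖ := fun x => by
    change ‖b.repr.symm (D (b.repr x))‖ ≤ _
    rw [LinearIsometryEquiv.norm_map]
    simpa using hD (b.repr x)
  refine ⟨S₀.mkContinuous C hS₀, ?_, fun x j => ?_⟩
  · have hin : ∀ x y, inner ℝ (S₀ x) y = ∑' j, s j * (b.repr x j * b.repr y j) := fun x y => by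
      change inner ℝ (b.repr.symm (D (b.repr x))) y = _
      rw [← b.repr.inner_map_map, LinearIsometryEquiv.apply_symm_apply, lp.inner_eq_tsum]
      refine tsum_congr fun j => ?_
      change b.repr y j * (s j * b.repr x j) = _
      ring
    rw [ContinuousLinearMap.isPositive_iff]
    constructor
    · intro x y
      change inner ℝ (S₀ x) y = inner ℝ x (S₀ y)
      rw [real_inner_comm (S₀ y) x, hin, hin]
      exact tsum_congr fun j => by ring
    · intro x
      change 0 ≤ inner ℝ (S₀ x) x
      rw [hin]
      exact tsum_nonneg fun j => mul_nonneg (hs j) (mul_self_nonneg _)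
  · change b.repr (b.repr.symm (D (b.repr x))) j = _
    rw [LinearIsometryEquiv.apply_symm_apply]
    rfl

variable {Q : U →L[ℝ] U} (η : HilbertBasis J ℝ U) {μ : J → ℝ}

theorem eigenvalue_nonneg (hQ : Q.IsPositive) (hη : ∀ j, Q (η j) = μ j • η j) (j : J) :
    0 ≤ μ j := by
  have h := hQ.inner_nonneg_left (η j)
  rwa [hη, real_inner_smul_left, real_inner_self_eq_norm_sq, η.orthonormal.1 j, one_pow,
    mul_one] at h

theorem eigenvalue_le (hη : ∀ j, Q (η j) = μ j • η j) (j : J) : μ j ≤ ‖Q‖ := by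
  have h := Q.le_opNorm (η j)
  rw [hη, norm_smul, η.orthonormal.1 j, mul_one, mul_one] at h
  exact (le_abs_self _).trans h

/-- The diagonal operator with entries √μ_j is a positive root of Q, so `sqrtOp Q` is not its
default value 0. -/
theorem sqrtOp_spec (hQ : Q.IsPositive) (hη : ∀ j, Q (η j) = μ j • η j) :
    (sqrtOp Q).IsPositive ∧ sqrtOp Q ∘L sqrtOp Q = Q := by
  have hex : ∃ S : U →L[ℝ] U, S.IsPositive ∧ S ∘L S = Q := by
    obtain ⟨S, hS, hrep⟩ := exists_isPositive_diagonal η (fun j => √(μ j))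
      (fun j => Real.sqrt_nonneg _) (√‖Q‖) (Real.sqrt_nonneg _)
      fun j => Real.sqrt_le_sqrt (eigenvalue_le η hη j)
    refine ⟨S, hS, ContinuousLinearMap.ext fun x => η.repr.injective ?_⟩
    ext j
    rw [ContinuousLinearMap.comp_apply, hrep, hrep, ← mul_assoc,
      Real.mul_self_sqrt (eigenvalue_nonneg η hQ hη j), η.repr_apply_apply, η.repr_apply_apply,
      ← hQ.inner_left_eq_inner_right, hη, real_inner_smul_left]
  rw [sqrtOp, dif_pos hex]
  exact hex.choose_spec

/-- `sqrtOp Q` is some positive root S of Q, so its action on η_j has to be deduced. If μ_j = 0,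
then ‖S η_j‖² = ⟨η_j, Q η_j⟩ = 0. If μ_j > 0, then y = S η_j − √μ_j η_j satisfies S y = −√μ_j y, and
positivity of S forces y = 0. -/
theorem sqrtOp_eigenvector (hQ : Q.IsPositive) (hη : ∀ j, Q (η j) = μ j • η j) (j : J) :
    sqrtOp Q (η j) = √(μ j) • η j := by
  obtain ⟨hS, hSS⟩ := sqrtOp_spec η hQ hη
  have hsq : sqrtOp Q (sqrtOp Q (η j)) = μ j • η j := by
    rw [← hη, ← ContinuousLinearMap.comp_apply, hSS]
  have hμ := eigenvalue_nonneg η hQ hη j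
  rcases hμ.eq_or_lt with h0 | hpos
  · rw [← h0, Real.sqrt_zero, zero_smul, ← inner_self_eq_zero (𝕜 := ℝ),
      hS.inner_left_eq_inner_right, hsq, ← h0, zero_smul, inner_zero_right]
  · set y := sqrtOp Q (η j) - √(μ j) • η j with hy
    have hSy : sqrtOp Q y = -√(μ j) • y := by
      rw [hy, map_sub, map_smul, hsq, smul_sub, smul_smul, neg_mul, Real.mul_self_sqrt hμ,
        neg_smul, neg_smul]
      abel
    have h := hS.inner_nonneg_left y
    rw [hSy, real_inner_smul_left, real_inner_self_eq_norm_sq] at h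
    have hs : 0 < √(μ j) := Real.sqrt_pos.2 hpos
    have hy0 : ‖y‖ ^ 2 = 0 := by nlinarith [sq_nonneg ‖y‖]
    exact sub_eq_zero.1 (norm_eq_zero.1 (by simpa using hy0))

end SquareRoot

/-! ### Multiplication operators on `U₀` -/

section Multiplication

theorem enorm_sq_eq_lintegral {d : ℕ} (f : HSp d) :
    ‖f‖ₑ ^ 2 = ∫⁻ x, ‖f x‖ₑ ^ 2 ∂cubeMeasure d := by
  have h := eLpNorm_nnreal_pow_eq_lintegral (μ := cubeMeasure d) (f := f) (p := 2) (by norm_num)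
  rw [Lp.enorm_def]
  simpa using h

theorem enorm_le_cNorm {d : ℕ} (φ : EuclideanSpace ℝ (Fin d) → ℝ) {x : EuclideanSpace ℝ (Fin d)}
    (hx : x ∈ cube d) : ‖φ x‖ₑ ≤ cNorm d φ :=
  le_iSup₂ (f := fun x (_ : x ∈ cube d) => ‖φ x‖ₑ) x hx

variable {d : ℕ} {c ρ : ℝ} {Q : HSp d →L[ℝ] HSp d} {J : Type*} [Countable J]
  (η : HilbertBasis J ℝ (HSp d)) {μ : J → ℝ} {φ : J → EuclideanSpace ℝ (Fin d) → ℝ}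

/-- Evaluation at a point of the cube, on `U₀`, is represented through `Q^{-1/2}` by a vector of
norm at most `√c`. -/
theorem exists_evaluation_vector (hQ : Q.IsPositive) (hη : ∀ j, Q (η j) = μ j • η j)
    (hηφ : ∀ j, η j =ᵐ[cubeMeasure d] φ j) (hc : 0 ≤ c)
    (hhol : ∑' j, ENNReal.ofReal (μ j) * holderNorm d ρ (φ j) ^ 2 ≤ ENNReal.ofReal c) :
    ∃ K : EuclideanSpace ℝ (Fin d) → HSp d, (∀ x ∈ cube d, ‖K x‖ ^ 2 ≤ c) ∧
      ∀ u : U0 Q, ∀ᵐ x ∂cubeMeasure d, U0.incl Q u x = inner ℝ (pinv Q u) (K x) := by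
  have hμ := eigenvalue_nonneg η hQ hη
  -- The Hölder norm dominates |φ_j(x)|, so the intended coordinates √μ_j φ_j(x) of K x are square
  -- summable with sum of squares at most c.
  have hsum : ∀ x ∈ cube d, ∀ s : Finset J, ∑ j ∈ s, ‖√(μ j) * φ j x‖ ^ 2 ≤ c := by
    intro x hx s
    rw [← ENNReal.ofReal_le_ofReal_iff hc, ENNReal.ofReal_sum_of_nonneg fun _ _ => by positivity]
    refine (Finset.sum_le_sum fun j _ => ?_).trans ((ENNReal.sum_le_tsum s).trans hhol)
    rw [norm_mul, mul_pow, Real.norm_of_nonneg (Real.sqrt_nonneg _), Real.sq_sqrt (hμ j),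
      ENNReal.ofReal_mul (hμ j), ENNReal.ofReal_pow (norm_nonneg _), ofReal_norm]
    gcongr
    exact (enorm_le_cNorm (φ j) hx).trans le_self_add
  have hmem : ∀ x ∈ cube d, Memℓp (fun j => √(μ j) * φ j x) 2 := fun x hx =>
    memℓp_gen' (C := c) fun s => by simpa using hsum x hx s
  classical
  let K : EuclideanSpace ℝ (Fin d) → HSp d := fun x =>
    if hx : x ∈ cube d then η.repr.symm ⟨fun j => √(μ j) * φ j x, hmem x hx⟩ else 0
  have hK : ∀ x ∈ cube d, ∀ j, inner ℝ (η j) (K x) = √(μ j) * φ j x := fun x hx j => by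
    rw [← η.repr_apply_apply]
    simp only [K, dif_pos hx, LinearIsometryEquiv.apply_symm_apply]
  refine ⟨K, fun x hx => ?_, fun u => ?_⟩
  · simp only [K, dif_pos hx, LinearIsometryEquiv.norm_map]
    have h := lp.norm_rpow_eq_tsum (p := 2) (by norm_num)
      (⟨fun j => √(μ j) * φ j x, hmem x hx⟩ : lp (fun _ : J => ℝ) 2)
    simp only [ENNReal.toReal_ofNat, Real.rpow_ofNat] at h
    rw [h]
    exact Real.tsum_le_of_sum_le (fun j => by positivity) (hsum x hx)
  · set p := pinv Q u with hp
    have hu : HasSum (fun j => (inner ℝ (η j) p * √(μ j)) • η j) (U0.incl Q u) := by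
      have h := (η.hasSum_repr p).mapL (sqrtOp Q)
      rw [sqrtOp_pinv] at h
      convert h using 2 with j
      rw [map_smul, sqrtOp_eigenvector η hQ hη, smul_smul, η.repr_apply_apply]
    -- The expansion of u converges only in L², so a subsequence of partial sums is taken that
    -- converges almost everywhere. On the cube the same sums converge to ⟨p, K x⟩ by Parseval, and
    -- the two limits agree.
    obtain ⟨F, hF, hFx⟩ := (tendstoInMeasure_of_tendsto_Lp hu).exists_seq_tendsto_ae'
    have hcoe : ∀ᵐ x ∂cubeMeasure d, ∀ n,
        (∑ j ∈ F n, (inner ℝ (η j) p * √(μ j)) • η j : HSp d) x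
          = ∑ j ∈ F n, ((inner ℝ (η j) p * √(μ j)) • η j : HSp d) x :=
      ae_all_iff.2 fun n => by
        filter_upwards [Lp.coeFn_finsetSum (F n)
          fun j => ((inner ℝ (η j) p * √(μ j)) • η j : HSp d)] with x hx
        rw [hx, Finset.sum_apply]
    have hcoe' : ∀ᵐ x ∂cubeMeasure d, ∀ j,
        ((inner ℝ (η j) p * √(μ j)) • η j : HSp d) x = inner ℝ (η j) p * √(μ j) * φ j x :=
      ae_all_iff.2 fun j => by
        filter_upwards [hηφ j, Lp.coeFn_smul (inner ℝ (η j) p * √(μ j)) (η j)] with x h1 h2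
        rw [h2, Pi.smul_apply, h1, smul_eq_mul]
    filter_upwards [hFx, hcoe, hcoe', ae_restrict_mem (measurableSet_cube d)] with x h1 h2 h3 hx
    refine tendsto_nhds_unique h1 ?_
    have h4 := (η.hasSum_inner_mul_inner p (K x)).comp hF
    refine h4.congr fun n => ?_
    simp only [Function.comp, h2, h3, hK x hx]
    refine Finset.sum_congr rfl fun j _ => ?_
    rw [real_inner_comm p]
    ring

variable {K : EuclideanSpace ℝ (Fin d) → HSp d}

theorem ae_abs_incl_le (hKc : ∀ x ∈ cube d, ‖K x‖ ^ 2 ≤ c)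
    (hK : ∀ u : U0 Q, ∀ᵐ x ∂cubeMeasure d, U0.incl Q u x = inner ℝ (pinv Q u) (K x)) (u : U0 Q) :
    ∀ᵐ x ∂cubeMeasure d, |U0.incl Q u x| ≤ ‖u‖ * √c := by
  filter_upwards [hK u, ae_restrict_mem (measurableSet_cube d)] with x h hx
  rw [h, U0.norm_eq]
  refine (abs_real_inner_le_norm _ _).trans ?_
  gcongr
  exact Real.le_sqrt_of_sq_le (hKc x hx)

/-- `pinv Q` preserves inner products, so this is Bessel's inequality for the vectors Q^{-1/2} ψ_i
tested against K x. Finite families keep the exceptional set null and suffice for the suprema that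
follow. -/
theorem ae_sum_incl_sq_le (hKc : ∀ x ∈ cube d, ‖K x‖ ^ 2 ≤ c)
    (hK : ∀ u : U0 Q, ∀ᵐ x ∂cubeMeasure d, U0.incl Q u x = inner ℝ (pinv Q u) (K x))
    {ι : Type*} {ψ : ι → U0 Q} (hψ : Orthonormal ℝ ψ) (s : Finset ι) :
    ∀ᵐ x ∂cubeMeasure d, ∑ i ∈ s, ‖U0.incl Q (ψ i) x‖ₑ ^ 2 ≤ ENNReal.ofReal c := by
  have hψ' : Orthonormal ℝ fun i => pinv Q (ψ i) := by
    classical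
    rw [orthonormal_iff_ite] at hψ ⊢
    exact fun i j => hψ i j
  have hall : ∀ᵐ x ∂cubeMeasure d, ∀ i ∈ s,
      U0.incl Q (ψ i) x = inner ℝ (pinv Q (ψ i)) (K x) :=
    (Filter.eventually_all_finset s).2 fun i _ => hK (ψ i)
  filter_upwards [hall, ae_restrict_mem (measurableSet_cube d)] with x h hx
  have hb := (hψ'.sum_inner_products_le (x := K x) (s := s)).trans (hKc x hx)
  refine le_trans (le_of_eq ?_) (ENNReal.ofReal_le_ofReal hb)
  rw [ENNReal.ofReal_sum_of_nonneg fun _ _ => by positivity]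
  refine Finset.sum_congr rfl fun i hi => ?_
  rw [h i hi, ENNReal.ofReal_pow (norm_nonneg _), ofReal_norm]

/-- The multiplication `m u w` is square integrable for `u, w ∈ U₀` when `m` is. -/
theorem memLp_mul_incl (hKc : ∀ x ∈ cube d, ‖K x‖ ^ 2 ≤ c)
    (hK : ∀ u : U0 Q, ∀ᵐ x ∂cubeMeasure d, U0.incl Q u x = inner ℝ (pinv Q u) (K x))
    {m : EuclideanSpace ℝ (Fin d) → ℝ} (hm : MemLp m 2 (cubeMeasure d)) (u w : U0 Q) :
    MemLp (fun x => m x * U0.incl Q u x * U0.incl Q w x) 2 (cubeMeasure d) := by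
  refine hm.of_le_mul (c := ‖u‖ * √c * (‖w‖ * √c)) ((hm.1.mul (Lp.aestronglyMeasurable _)).mul
    (Lp.aestronglyMeasurable _)) ?_
  filter_upwards [ae_abs_incl_le hKc hK u, ae_abs_incl_le hKc hK w] with x hu hw
  rw [norm_mul, norm_mul, mul_assoc, mul_comm]
  exact mul_le_mul_of_nonneg_right (mul_le_mul hu hw (abs_nonneg _) (by positivity))
    (norm_nonneg _)

theorem bilinMul_ae (hKc : ∀ x ∈ cube d, ‖K x‖ ^ 2 ≤ c)
    (hK : ∀ u : U0 Q, ∀ᵐ x ∂cubeMeasure d, U0.incl Q u x = inner ℝ (pinv Q u) (K x))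
    {m : EuclideanSpace ℝ (Fin d) → ℝ} (hm : MemLp m 2 (cubeMeasure d)) (u w : U0 Q) :
    bilinMul m (U0.incl Q u) (U0.incl Q w)
      =ᵐ[cubeMeasure d] fun x => m x * U0.incl Q u x * U0.incl Q w x := by
  rw [bilinMul, dif_pos (memLp_mul_incl hKc hK hm u w)]
  exact MemLp.coeFn_toLp _

/-- A multiplication operator with square integrable multiplier is a bounded bilinear operator. -/
theorem exists_clm_of_ae_eq_mul (hKc : ∀ x ∈ cube d, ‖K x‖ ^ 2 ≤ c)
    (hK : ∀ u : U0 Q, ∀ᵐ x ∂cubeMeasure d, U0.incl Q u x = inner ℝ (pinv Q u) (K x))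
    {m : EuclideanSpace ℝ (Fin d) → ℝ} (hm : MemLp m 2 (cubeMeasure d)) {B : U0 Q → U0 Q → HSp d}
    (hB : ∀ u w, B u w =ᵐ[cubeMeasure d] fun x => m x * U0.incl Q u x * U0.incl Q w x) :
    ∃ B' : U0 Q →L[ℝ] U0 Q →L[ℝ] HSp d, ∀ u w, B' u w = B u w := by
  let L : U0 Q →ₗ[ℝ] U0 Q →ₗ[ℝ] HSp d := LinearMap.mk₂ ℝ B
    (fun u v w => by
      refine Lp.ext ?_
      filter_upwards [hB (u + v) w, hB u w, hB v w, Lp.coeFn_add (B u w) (B v w),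
        Lp.coeFn_add (U0.incl Q u) (U0.incl Q v)] with x h1 h2 h3 h4 h5
      rw [h1, h4, Pi.add_apply, h2, h3, map_add, h5, Pi.add_apply]
      ring)
    (fun r u w => by
      refine Lp.ext ?_
      filter_upwards [hB (r • u) w, hB u w, Lp.coeFn_smul r (B u w),
        Lp.coeFn_smul r (U0.incl Q u)] with x h1 h2 h3 h4
      rw [h1, h3, Pi.smul_apply, h2, map_smul, h4, Pi.smul_apply, smul_eq_mul, smul_eq_mul]
      ring)
    (fun u v w => by
      refine Lp.ext ?_
      filter_upwards [hB u (v + w), hB u v, hB u w, Lp.coeFn_add (B u v) (B u w),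
        Lp.coeFn_add (U0.incl Q v) (U0.incl Q w)] with x h1 h2 h3 h4 h5
      rw [h1, h4, Pi.add_apply, h2, h3, map_add, h5, Pi.add_apply]
      ring)
    (fun r u w => by
      refine Lp.ext ?_
      filter_upwards [hB u (r • w), hB u w, Lp.coeFn_smul r (B u w),
        Lp.coeFn_smul r (U0.incl Q w)] with x h1 h2 h3 h4
      rw [h1, h3, Pi.smul_apply, h2, map_smul, h4, Pi.smul_apply, smul_eq_mul, smul_eq_mul]
      ring)
  refine ⟨L.mkContinuous₂ (√c * √c * ‖hm.toLp m‖) fun u w => ?_, fun u w => rfl⟩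
  have h : ‖B u w‖ ≤ ‖u‖ * √c * (‖w‖ * √c) * ‖hm.toLp m‖ := by
    refine Lp.norm_le_mul_norm_of_ae_le_mul ?_
    filter_upwards [hB u w, ae_abs_incl_le hKc hK u, ae_abs_incl_le hKc hK w,
      hm.coeFn_toLp] with x h hu hw hmx
    rw [h, hmx, norm_mul, norm_mul, mul_assoc, mul_comm]
    exact mul_le_mul_of_nonneg_right (mul_le_mul hu hw (abs_nonneg _) (by positivity))
      (norm_nonneg _)
  exact h.trans_eq (by ring)

/-- The Hilbert–Schmidt bound for multiplication operators on `U₀ × U₀`. -/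
theorem hs2NormSq_le_of_ae_eq_mul (hKc : ∀ x ∈ cube d, ‖K x‖ ^ 2 ≤ c)
    (hK : ∀ u : U0 Q, ∀ᵐ x ∂cubeMeasure d, U0.incl Q u x = inner ℝ (pinv Q u) (K x))
    {m : EuclideanSpace ℝ (Fin d) → ℝ} {B : U0 Q → U0 Q → HSp d}
    (hB : ∀ u w, B u w =ᵐ[cubeMeasure d] fun x => m x * U0.incl Q u x * U0.incl Q w x) :
    hs2NormSq B ≤ ENNReal.ofReal c ^ 2 * ∫⁻ x, ‖m x‖ₑ ^ 2 ∂cubeMeasure d := by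
  refine iSup₂_le fun s ψ => ?_
  -- On a finite block the sum moves under the integral, where the integrand factors as |m|² (∑
  -- |ψ_i|²)(∑ |ψ_j|²).
  have hfin : ∀ F G : Finset s, ∑ i ∈ F, ∑ j ∈ G, ‖B (ψ i) (ψ j)‖ₑ ^ 2
      ≤ ENNReal.ofReal c ^ 2 * ∫⁻ x, ‖m x‖ₑ ^ 2 ∂cubeMeasure d := by
    intro F G
    have hmeas : ∀ i j, AEMeasurable (fun x => ‖B (ψ i) (ψ j) x‖ₑ ^ 2) (cubeMeasure d) :=
      fun i j => (Lp.aestronglyMeasurable _).enorm.pow_const 2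
    have hall : ∀ᵐ x ∂cubeMeasure d, ∀ i ∈ F, ∀ j ∈ G, B (ψ i) (ψ j) x
        = m x * U0.incl Q (ψ i) x * U0.incl Q (ψ j) x :=
      (Filter.eventually_all_finset F).2 fun i _ =>
        (Filter.eventually_all_finset G).2 fun j _ => hB (ψ i) (ψ j)
    calc ∑ i ∈ F, ∑ j ∈ G, ‖B (ψ i) (ψ j)‖ₑ ^ 2
        = ∫⁻ x, ∑ i ∈ F, ∑ j ∈ G, ‖B (ψ i) (ψ j) x‖ₑ ^ 2 ∂cubeMeasure d := by
          rw [lintegral_finsetSum' _ fun i _ => Finset.aemeasurable_fun_sum _ fun j _ => hmeas i j]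
          refine Finset.sum_congr rfl fun i _ => ?_
          rw [lintegral_finsetSum' _ fun j _ => hmeas i j]
          exact Finset.sum_congr rfl fun j _ => enorm_sq_eq_lintegral _
      _ ≤ ∫⁻ x, ENNReal.ofReal c ^ 2 * ‖m x‖ₑ ^ 2 ∂cubeMeasure d := by
          refine lintegral_mono_ae ?_
          filter_upwards [hall, ae_sum_incl_sq_le hKc hK ψ.orthonormal F,
            ae_sum_incl_sq_le hKc hK ψ.orthonormal G] with x h hF hG
          calc ∑ i ∈ F, ∑ j ∈ G, ‖B (ψ i) (ψ j) x‖ₑ ^ 2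
              = ((∑ i ∈ F, ‖U0.incl Q (ψ i) x‖ₑ ^ 2) * ∑ j ∈ G, ‖U0.incl Q (ψ j) x‖ₑ ^ 2)
                  * ‖m x‖ₑ ^ 2 := by
                rw [Finset.sum_mul_sum, Finset.sum_mul]
                refine Finset.sum_congr rfl fun i hi => ?_
                rw [Finset.sum_mul]
                refine Finset.sum_congr rfl fun j hj => ?_
                rw [h i hi j hj, enorm_mul, enorm_mul]
                ring
            _ ≤ _ := by
                rw [sq (ENNReal.ofReal c)]
                gcongr
      _ = _ := lintegral_const_mul' _ _ (by finiteness)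
  rw [ENNReal.tsum_eq_iSup_sum]
  refine iSup_le fun F => ?_
  rw [← Summable.tsum_finsetSum fun i _ => ENNReal.summable, ENNReal.tsum_eq_iSup_sum]
  refine iSup_le fun G => ?_
  rw [Finset.sum_comm]
  exact hfin F G

theorem lintegral_enorm_sq_lt_top {m : EuclideanSpace ℝ (Fin d) → ℝ}
    (hm : MemLp m 2 (cubeMeasure d)) : ∫⁻ x, ‖m x‖ₑ ^ 2 ∂cubeMeasure d < ∞ := by
  have h := eLpNorm_nnreal_pow_eq_lintegral (μ := cubeMeasure d) (f := m) (p := 2) (by norm_num)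
  have h2 := ENNReal.pow_lt_top (n := 2) hm.2
  simp only [NNReal.coe_ofNat, ENNReal.rpow_ofNat, ENNReal.coe_ofNat] at h
  rwa [h] at h2

theorem isHS2_of_ae_eq_mul (hKc : ∀ x ∈ cube d, ‖K x‖ ^ 2 ≤ c)
    (hK : ∀ u : U0 Q, ∀ᵐ x ∂cubeMeasure d, U0.incl Q u x = inner ℝ (pinv Q u) (K x))
    {m : EuclideanSpace ℝ (Fin d) → ℝ} (hm : MemLp m 2 (cubeMeasure d)) {B : U0 Q → U0 Q → HSp d}
    (hB : ∀ u w, B u w =ᵐ[cubeMeasure d] fun x => m x * U0.incl Q u x * U0.incl Q w x) :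
    IsHS2 B :=
  ⟨exists_clm_of_ae_eq_mul hKc hK hm hB, (hs2NormSq_le_of_ae_eq_mul hKc hK hB).trans_lt
    (ENNReal.mul_lt_top (by finiteness) (lintegral_enorm_sq_lt_top hm))⟩

end Multiplication

/-! ### The coefficient functions -/

section Coefficients

theorem isOpen_cube (d : ℕ) : IsOpen (cube d) := by
  have : cube d = ⋂ i, (fun x : EuclideanSpace ℝ (Fin d) => x i) ⁻¹' Ioo (0 : ℝ) 1 := by
    ext x; simp [cube]
  rw [this]
  exact isOpen_iInter_of_finite fun i => isOpen_Ioo.preimage (by fun_prop)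

variable {d : ℕ} {c : ℝ} {g : EuclideanSpace ℝ (Fin d) → ℝ → ℝ}

theorem contDiff_section
    (hg : ContDiffOn ℝ 2 (fun p : EuclideanSpace ℝ (Fin d) × ℝ => g p.1 p.2) (cube d ×ˢ univ))
    {x : EuclideanSpace ℝ (Fin d)} (hx : x ∈ cube d) : ContDiff ℝ 2 (g x) := by
  rw [← contDiffOn_univ]
  exact hg.comp (f := fun y : ℝ => (x, y)) (by fun_prop) fun y _ => ⟨hx, mem_univ _⟩

theorem abs_section_sub_le
    (hg : ContDiffOn ℝ 2 (fun p : EuclideanSpace ℝ (Fin d) × ℝ => g p.1 p.2) (cube d ×ˢ univ))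
    (hg1 : ∀ x ∈ cube d, ∀ y : ℝ, |deriv (g x) y| ≤ c)
    {x : EuclideanSpace ℝ (Fin d)} (hx : x ∈ cube d) (y z : ℝ) :
    |g x y - g x z| ≤ c * |y - z| :=
  convex_univ.norm_image_sub_le_of_norm_deriv_le
    (fun w _ => ((contDiff_section hg hx).differentiable (by norm_num)).differentiableAt)
    (fun w _ => hg1 x hx w) (mem_univ z) (mem_univ y)

theorem abs_section_le
    (hg : ContDiffOn ℝ 2 (fun p : EuclideanSpace ℝ (Fin d) × ℝ => g p.1 p.2) (cube d ×ˢ univ))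
    (hg0 : ∀ x ∈ cube d, |g x 0| ≤ c) (hg1 : ∀ x ∈ cube d, ∀ y : ℝ, |deriv (g x) y| ≤ c)
    {x : EuclideanSpace ℝ (Fin d)} (hx : x ∈ cube d) (y : ℝ) :
    |g x y| ≤ c * (1 + |y|) := by
  have h := abs_section_sub_le hg hg1 hx y 0
  rw [sub_zero] at h
  have := abs_sub_abs_le_abs_sub (g x y) (g x 0)
  linarith [hg0 x hx]

/-- The mean value inequality is used twice: ∂_y g is c-Lipschitz, hence z ↦ g(x,z) − ∂_y g(x,y) z
has derivative at most c|t| on the ball of radius |t| about y. The sharp constant c/2 is not needed.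
-/
theorem abs_section_taylor_le
    (hg : ContDiffOn ℝ 2 (fun p : EuclideanSpace ℝ (Fin d) × ℝ => g p.1 p.2) (cube d ×ˢ univ))
    (hg2 : ∀ x ∈ cube d, ∀ y : ℝ, |iteratedDeriv 2 (g x) y| ≤ c) (hc : 0 ≤ c)
    {x : EuclideanSpace ℝ (Fin d)} (hx : x ∈ cube d) (y t : ℝ) :
    |g x (y + t) - g x y - deriv (g x) y * t| ≤ c * t ^ 2 := by
  have hC := contDiff_section hg hx
  have hd : Differentiable ℝ (g x) := hC.differentiable (by norm_num)
  have hd' : Differentiable ℝ (deriv (g x)) := by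
    have h := hC.differentiable_iteratedDeriv 1 (by norm_num)
    rwa [iteratedDeriv_one] at h
  have hlip : ∀ z, |deriv (g x) z - deriv (g x) y| ≤ c * |z - y| := fun z =>
    convex_univ.norm_image_sub_le_of_norm_deriv_le (fun w _ => hd'.differentiableAt)
      (fun w _ => by
        have h := hg2 x hx w
        rwa [iteratedDeriv_succ, iteratedDeriv_one] at h) (mem_univ y) (mem_univ z)
  have hF : ∀ z, HasDerivAt (fun z => g x z - deriv (g x) y * z)
      (deriv (g x) z - deriv (g x) y) z := fun z => by
    have h := (hd z).hasDerivAt.sub ((hasDerivAt_id z).const_mul (deriv (g x) y))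
    rwa [mul_one] at h
  have h := (convex_closedBall y |t|).norm_image_sub_le_of_norm_hasDerivWithin_le (C := c * |t|)
    (fun z _ => (hF z).hasDerivWithinAt)
    (fun z hz => (hlip z).trans (mul_le_mul_of_nonneg_left (by simpa [Real.dist_eq] using hz) hc))
    (Metric.mem_closedBall_self (abs_nonneg t))
    (show y + t ∈ Metric.closedBall y |t| by simp)
  rw [add_sub_cancel_left, Real.norm_eq_abs, Real.norm_eq_abs, mul_assoc, abs_mul_abs_self] at h
  rw [sq]
  convert h using 2
  ring

/-- Nothing is known about g off the cube, so it is replaced there by 0; the resulting function is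
Borel on the product and agrees with g almost everywhere for `cubeMeasure`. -/
theorem aestronglyMeasurable_section_comp
    (hg : ContDiffOn ℝ 2 (fun p : EuclideanSpace ℝ (Fin d) × ℝ => g p.1 p.2) (cube d ×ˢ univ))
    {f : EuclideanSpace ℝ (Fin d) → ℝ} (hf : AEStronglyMeasurable f (cubeMeasure d)) :
    AEStronglyMeasurable (fun x => g x (f x)) (cubeMeasure d) := by
  classical
  let G : EuclideanSpace ℝ (Fin d) × ℝ → ℝ :=
    (cube d ×ˢ univ).piecewise (fun p => g p.1 p.2) fun _ => 0
  have hG : Measurable G := hg.continuousOn.measurable_piecewise continuousOn_const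
    ((measurableSet_cube d).prod MeasurableSet.univ)
  refine ((hG.comp_aemeasurable (aemeasurable_id.prodMk hf.aemeasurable)).congr
    ?_).aestronglyMeasurable
  filter_upwards [ae_restrict_mem (measurableSet_cube d)] with x hx
  exact piecewise_eq_of_mem _ (fun p : EuclideanSpace ℝ (Fin d) × ℝ => g p.1 p.2) (fun _ => 0)
    (show (x, f x) ∈ cube d ×ˢ univ from ⟨hx, mem_univ _⟩)

/-- The derivative is the pointwise limit on the cube of the difference quotients with steps
1/(n+1), each measurable by the preceding lemma. -/
theorem aestronglyMeasurable_deriv_section_comp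
    (hg : ContDiffOn ℝ 2 (fun p : EuclideanSpace ℝ (Fin d) × ℝ => g p.1 p.2) (cube d ×ˢ univ))
    {f : EuclideanSpace ℝ (Fin d) → ℝ} (hf : AEStronglyMeasurable f (cubeMeasure d)) :
    AEStronglyMeasurable (fun x => deriv (g x) (f x)) (cubeMeasure d) := by
  let t : ℕ → ℝ := fun n => 1 / ((n : ℝ) + 1)
  have ht : Filter.Tendsto t Filter.atTop (nhdsWithin 0 {0}ᶜ) :=
    tendsto_nhdsWithin_iff.2 ⟨tendsto_one_div_add_atTop_nhds_zero_nat,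
      Filter.Eventually.of_forall fun n => (Nat.one_div_pos_of_nat (α := ℝ)).ne'⟩
  refine aestronglyMeasurable_of_tendsto_ae Filter.atTop
    (f := fun n x => (t n)⁻¹ • (g x (f x + t n) - g x (f x))) (fun n => ?_) ?_
  · exact ((aestronglyMeasurable_section_comp hg (hf.add aestronglyMeasurable_const)).sub
      (aestronglyMeasurable_section_comp hg hf)).const_smul ((t n)⁻¹)
  · filter_upwards [ae_restrict_mem (measurableSet_cube d)] with x hx
    exact (((contDiff_section hg hx).differentiable (by norm_num)
      (f x)).hasDerivAt.tendsto_slope_zero).comp ht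

theorem aestronglyMeasurable_fdCoeff
    (hg : ContDiffOn ℝ 2 (fun p : EuclideanSpace ℝ (Fin d) × ℝ => g p.1 p.2) (cube d ×ˢ univ))
    (v : HSp d) (h : ℝ) : AEStronglyMeasurable (fdCoeff g v h) (cubeMeasure d) :=
  ((aestronglyMeasurable_section_comp hg ((Lp.aestronglyMeasurable v).add
    ((aestronglyMeasurable_section_comp hg (Lp.aestronglyMeasurable v)).const_mul _))).sub
    (aestronglyMeasurable_section_comp hg (Lp.aestronglyMeasurable v))).const_mul _

theorem aestronglyMeasurable_milCoeff
    (hg : ContDiffOn ℝ 2 (fun p : EuclideanSpace ℝ (Fin d) × ℝ => g p.1 p.2) (cube d ×ˢ univ))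
    (v : HSp d) : AEStronglyMeasurable (milCoeff g v) (cubeMeasure d) :=
  (aestronglyMeasurable_deriv_section_comp hg (Lp.aestronglyMeasurable v)).mul
    (aestronglyMeasurable_section_comp hg (Lp.aestronglyMeasurable v))

theorem abs_fdCoeff_le
    (hg : ContDiffOn ℝ 2 (fun p : EuclideanSpace ℝ (Fin d) × ℝ => g p.1 p.2) (cube d ×ˢ univ))
    (hg0 : ∀ x ∈ cube d, |g x 0| ≤ c) (hg1 : ∀ x ∈ cube d, ∀ y : ℝ, |deriv (g x) y| ≤ c)
    (hc : 0 ≤ c) (v : HSp d) {h : ℝ} (hh : 0 < h) {x : EuclideanSpace ℝ (Fin d)}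
    (hx : x ∈ cube d) : |fdCoeff g v h x| ≤ c * (c * (1 + |v x|)) := by
  have hs : 0 < √h := Real.sqrt_pos.2 hh
  have h1 := abs_section_sub_le hg hg1 hx (v x + √h * g x (v x)) (v x)
  rw [add_sub_cancel_left, abs_mul, abs_of_pos hs] at h1
  rw [fdCoeff, abs_mul, abs_of_pos (by positivity), one_div, inv_mul_le_iff₀ hs]
  have h2 := mul_le_mul_of_nonneg_left (abs_section_le hg hg0 hg1 hx (v x))
    (mul_nonneg hc hs.le)
  linarith

theorem abs_milCoeff_le
    (hg : ContDiffOn ℝ 2 (fun p : EuclideanSpace ℝ (Fin d) × ℝ => g p.1 p.2) (cube d ×ˢ univ))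
    (hg0 : ∀ x ∈ cube d, |g x 0| ≤ c) (hg1 : ∀ x ∈ cube d, ∀ y : ℝ, |deriv (g x) y| ≤ c)
    (hc : 0 ≤ c) (v : HSp d) {x : EuclideanSpace ℝ (Fin d)}
    (hx : x ∈ cube d) : |milCoeff g v x| ≤ c * (c * (1 + |v x|)) := by
  rw [milCoeff, abs_mul]
  exact mul_le_mul (hg1 x hx _) (abs_section_le hg hg0 hg1 hx _) (abs_nonneg _) hc

theorem memLp_of_linear_growth {m : EuclideanSpace ℝ (Fin d) → ℝ}
    (hm : AEStronglyMeasurable m (cubeMeasure d)) (v : HSp d) {C : ℝ}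
    (hmC : ∀ x ∈ cube d, |m x| ≤ C * (1 + |v x|)) : MemLp m 2 (cubeMeasure d) := by
  refine ((memLp_const (1 : ℝ)).add (Lp.memLp v).norm).of_le_mul (c := C) hm ?_
  filter_upwards [ae_restrict_mem (measurableSet_cube d)] with x hx
  refine (hmC x hx).trans_eq ?_
  rw [Pi.add_apply, Real.norm_of_nonneg (by positivity), Real.norm_eq_abs]

theorem memLp_fdCoeff
    (hg : ContDiffOn ℝ 2 (fun p : EuclideanSpace ℝ (Fin d) × ℝ => g p.1 p.2) (cube d ×ˢ univ))
    (hg0 : ∀ x ∈ cube d, |g x 0| ≤ c) (hg1 : ∀ x ∈ cube d, ∀ y : ℝ, |deriv (g x) y| ≤ c)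
    (hc : 0 ≤ c) (v : HSp d) {h : ℝ} (hh : 0 < h) : MemLp (fdCoeff g v h) 2 (cubeMeasure d) :=
  memLp_of_linear_growth (C := c * c) (aestronglyMeasurable_fdCoeff hg v h) v fun x hx => by
    simpa only [mul_assoc] using abs_fdCoeff_le hg hg0 hg1 hc v hh hx

theorem memLp_milCoeff
    (hg : ContDiffOn ℝ 2 (fun p : EuclideanSpace ℝ (Fin d) × ℝ => g p.1 p.2) (cube d ×ˢ univ))
    (hg0 : ∀ x ∈ cube d, |g x 0| ≤ c) (hg1 : ∀ x ∈ cube d, ∀ y : ℝ, |deriv (g x) y| ≤ c)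
    (hc : 0 ≤ c) (v : HSp d) : MemLp (milCoeff g v) 2 (cubeMeasure d) :=
  memLp_of_linear_growth (C := c * c) (aestronglyMeasurable_milCoeff hg v) v fun x hx => by
    simpa only [mul_assoc] using abs_milCoeff_le hg hg0 hg1 hc v hx

/-- The two values of g in the difference quotient are compared separately, so the factor 1/√h is
not cancelled. The term √h c comes from the shift inside the argument of g. -/
theorem abs_fdCoeff_sub_le
    (hg : ContDiffOn ℝ 2 (fun p : EuclideanSpace ℝ (Fin d) × ℝ => g p.1 p.2) (cube d ×ˢ univ))
    (hg1 : ∀ x ∈ cube d, ∀ y : ℝ, |deriv (g x) y| ≤ c) (hc : 0 ≤ c) (v w : HSp d) {h : ℝ}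
    (hh : 0 < h) {x : EuclideanSpace ℝ (Fin d)} (hx : x ∈ cube d) :
    |fdCoeff g v h x - fdCoeff g w h x| ≤ c * (2 + √h * c) / √h * |v x - w x| := by
  have hs : 0 < √h := Real.sqrt_pos.2 hh
  have h1 := abs_section_sub_le hg hg1 hx (v x) (w x)
  have h2 := abs_section_sub_le hg hg1 hx (v x + √h * g x (v x)) (w x + √h * g x (w x))
  have h3 : |v x + √h * g x (v x) - (w x + √h * g x (w x))|
      ≤ |v x - w x| + √h * |g x (v x) - g x (w x)| := by
    rw [← abs_of_pos hs, ← abs_mul, abs_of_pos hs]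
    refine le_trans (le_of_eq ?_) (abs_add_le _ _)
    congr 1
    ring
  have h4 : |fdCoeff g v h x - fdCoeff g w h x|
      ≤ 1 / √h * (|g x (v x + √h * g x (v x)) - g x (w x + √h * g x (w x))|
        + |g x (v x) - g x (w x)|) := by
    rw [fdCoeff, fdCoeff, ← mul_sub, abs_mul, abs_of_pos (by positivity)]
    gcongr
    refine le_trans (le_of_eq ?_) (abs_sub _ _)
    congr 1
    ring
  refine h4.trans ?_
  calc _ ≤ 1 / √h * (c * (|v x - w x| + √h * (c * |v x - w x|)) + c * |v x - w x|) := by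
        gcongr
        exact h2.trans (mul_le_mul_of_nonneg_left (h3.trans (by gcongr)) hc)
    _ = _ := by ring

/-- The Taylor remainder for the increment √h g is at most c h g²; division by √h leaves one √h, and
linear growth of g gives the quadratic factor in v. -/
theorem abs_fdCoeff_sub_milCoeff_le
    (hg : ContDiffOn ℝ 2 (fun p : EuclideanSpace ℝ (Fin d) × ℝ => g p.1 p.2) (cube d ×ˢ univ))
    (hg0 : ∀ x ∈ cube d, |g x 0| ≤ c) (hg1 : ∀ x ∈ cube d, ∀ y : ℝ, |deriv (g x) y| ≤ c)
    (hg2 : ∀ x ∈ cube d, ∀ y : ℝ, |iteratedDeriv 2 (g x) y| ≤ c) (hc : 0 ≤ c)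
    (v : HSp d) {h : ℝ} (hh : 0 < h) {x : EuclideanSpace ℝ (Fin d)} (hx : x ∈ cube d) :
    |fdCoeff g v h x - milCoeff g v x| ≤ √h * c ^ 3 * (1 + |v x|) ^ 2 := by
  have hs : 0 < √h := Real.sqrt_pos.2 hh
  have h1 := abs_section_taylor_le hg hg2 hc hx (v x) (√h * g x (v x))
  have h2 : fdCoeff g v h x - milCoeff g v x = 1 / √h * (g x (v x + √h * g x (v x)) - g x (v x)
      - deriv (g x) (v x) * (√h * g x (v x))) := by
    rw [fdCoeff, milCoeff]
    field_simp
  have h3 : g x (v x) ^ 2 ≤ (c * (1 + |v x|)) ^ 2 :=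
    sq_le_sq.2 ((abs_section_le hg hg0 hg1 hx (v x)).trans (le_abs_self _))
  rw [h2, abs_mul, abs_of_pos (by positivity)]
  calc _ ≤ 1 / √h * (c * (√h * g x (v x)) ^ 2) := by gcongr
    _ = √h * c * g x (v x) ^ 2 := by field_simp
    _ ≤ √h * c * (c * (1 + |v x|)) ^ 2 := by gcongr
    _ = _ := by ring

end Coefficients

/-! ### Orthonormality of the sine system -/

section Orthonormality

/-- Fubini, stated for a general side and scalar field so as to serve both the sines on (0,1)^d and
the characters on (-1,1)^d. -/
theorem setIntegral_box_prod {𝕜 : Type*} [RCLike 𝕜] {d : ℕ} (I : Set ℝ)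
    (f : Fin d → ℝ → 𝕜) :
    ∫ x in {x : EuclideanSpace ℝ (Fin d) | ∀ i, x i ∈ I}, ∏ j, f j (x j)
      = ∏ j, ∫ y in I, f j y := by
  have hpre : {x : EuclideanSpace ℝ (Fin d) | ∀ i, x i ∈ I}
      = (MeasurableEquiv.toLp 2 (Fin d → ℝ)).symm ⁻¹' (univ.pi fun _ => I) := by
    ext x; simp
  rw [hpre]
  refine ((EuclideanSpace.volume_preserving_symm_measurableEquiv_toLp
    (Fin d)).setIntegral_preimage_emb (MeasurableEquiv.measurableEmbedding _)
    (fun y : Fin d → ℝ => ∏ j, f j (y j)) _).trans ?_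
  rw [volume_pi, Measure.restrict_pi_pi, integral_fintype_prod_eq_prod]

theorem integral_cos_int_mul_pi (n : ℤ) :
    ∫ x in Ioo (0 : ℝ) 1, Real.cos (n * Real.pi * x) = if n = 0 then 1 else 0 := by
  rw [← integral_Ioc_eq_integral_Ioo, ← intervalIntegral.integral_of_le zero_le_one]
  split_ifs with hn
  · simp [hn]
  · have hn' : (n : ℝ) * Real.pi ≠ 0 := mul_ne_zero (by exact_mod_cast hn) Real.pi_ne_zero
    rw [intervalIntegral.integral_comp_mul_left _ hn']
    simp [Real.sin_int_mul_pi]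

theorem integral_sin_mul_sin (m n : ℕ+) :
    ∫ x in Ioo (0 : ℝ) 1, Real.sin ((m : ℕ) * Real.pi * x) * Real.sin ((n : ℕ) * Real.pi * x)
      = if m = n then 1 / 2 else 0 := by
  have hint : ∀ k : ℤ, IntegrableOn (fun x : ℝ => Real.cos (k * Real.pi * x)) (Ioo 0 1) :=
    fun k => ((by fun_prop : Continuous fun x : ℝ =>
      Real.cos (k * Real.pi * x)).integrableOn_Icc (a := 0) (b := 1)).mono_set Ioo_subset_Icc_self
  have heq : ∀ x : ℝ, Real.sin ((m : ℕ) * Real.pi * x) * Real.sin ((n : ℕ) * Real.pi * x)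
      = 1 / 2 * (Real.cos (((m : ℤ) - (n : ℤ) : ℤ) * Real.pi * x)
        - Real.cos (((m : ℤ) + (n : ℤ) : ℤ) * Real.pi * x)) := fun x => by
    push_cast
    rw [sub_mul, sub_mul, add_mul, add_mul, Real.cos_sub, Real.cos_add]
    ring
  simp_rw [heq]
  have hmn : (m : ℤ) + (n : ℤ) ≠ 0 := by
    have := m.pos; omega
  rw [integral_const_mul, integral_sub (hint _) (hint _), integral_cos_int_mul_pi,
    integral_cos_int_mul_pi, if_neg hmn, sub_zero]
  have : ((m : ℤ) - (n : ℤ) = 0) ↔ m = n := by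
    rw [sub_eq_zero]; norm_cast
  simp [this]

theorem orthonormal_eig (d : ℕ) : Orthonormal ℝ (eig : (Fin d → ℕ+) → HSp d) := by
  rw [orthonormal_iff_ite]
  intro i j
  have h1 : inner ℝ (eig i) (eig j) = ∫ x in cube d, eigFun i x * eigFun j x := by
    rw [L2.inner_def]
    refine integral_congr_ae ?_
    filter_upwards [(memLp_eigFun i).coeFn_toLp, (memLp_eigFun j).coeFn_toLp] with x hi hj
    rw [eig, eig, hi, hj]
    exact mul_comm _ _
  -- The normalisation 2^{d/2} · 2^{d/2} = 2^d is distributed as one factor 2 per coordinate.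
  have h2 : ∀ x, eigFun i x * eigFun j x = ∏ l, 2 * (Real.sin ((i l : ℕ) * Real.pi * x l)
      * Real.sin ((j l : ℕ) * Real.pi * x l)) := fun x => by
    rw [Finset.prod_mul_distrib, Finset.prod_mul_distrib, Finset.prod_const, Finset.card_univ,
      Fintype.card_fin, eigFun, eigFun, mul_mul_mul_comm, ← Real.rpow_add two_pos, add_halves,
      Real.rpow_natCast]
  rw [h1]
  simp_rw [h2]
  refine (setIntegral_box_prod (Ioo 0 1) fun l y =>
    2 * (Real.sin ((i l : ℕ) * Real.pi * y) * Real.sin ((j l : ℕ) * Real.pi * y))).trans ?_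
  simp_rw [integral_const_mul, integral_sin_mul_sin]
  split_ifs with h
  · simp [h]
  · obtain ⟨l, hl⟩ := Function.ne_iff.1 h
    exact Finset.prod_eq_zero (Finset.mem_univ l) (by simp [hl])

end Orthonormality

/-! ### Completeness of the sine system -/

section Completeness

/-- The product `∏_j sin(n_j π x_j)` with integer frequencies. -/
def sinProd {d : ℕ} (n : Fin d → ℤ) (x : EuclideanSpace ℝ (Fin d)) : ℝ :=
  ∏ j, Real.sin (n j * Real.pi * x j)

theorem continuous_sinProd {d : ℕ} (n : Fin d → ℤ) : Continuous (sinProd n) := by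
  unfold sinProd
  fun_prop

theorem abs_sinProd_le {d : ℕ} (n : Fin d → ℤ) (x : EuclideanSpace ℝ (Fin d)) :
    |sinProd n x| ≤ 1 := by
  rw [sinProd, Finset.abs_prod]
  exact Finset.prod_le_one (fun _ _ => abs_nonneg _) fun j _ => Real.abs_sin_le_one _

/-- Product-to-sum in one coordinate. Zero and negative frequencies are admitted so that the family
is closed under the shifts n_l ± 1. -/
theorem sinProd_mul_cos {d : ℕ} (n : Fin d → ℤ) (l : Fin d) (x : EuclideanSpace ℝ (Fin d)) :
    sinProd n x * Real.cos (Real.pi * x l)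
      = 1 / 2 * (sinProd (Function.update n l (n l + 1)) x
        + sinProd (Function.update n l (n l - 1)) x) := by
  have h : ∀ m : Fin d → ℤ, sinProd m x = Real.sin (m l * Real.pi * x l)
      * ∏ j ∈ Finset.univ.erase l, Real.sin (m j * Real.pi * x j) := fun m =>
    (Finset.mul_prod_erase _ _ (Finset.mem_univ l)).symm
  have hu : ∀ k : ℤ, ∏ j ∈ Finset.univ.erase l,
      Real.sin ((Function.update n l k j : ℤ) * Real.pi * x j)
      = ∏ j ∈ Finset.univ.erase l, Real.sin (n j * Real.pi * x j) := fun k =>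
    Finset.prod_congr rfl fun j hj => by
      rw [Function.update_of_ne (Finset.ne_of_mem_erase hj)]
  rw [h n, h (Function.update n l _), h (Function.update n l _), hu, hu, Function.update_self,
    Function.update_self]
  push_cast
  rw [add_mul, add_mul, sub_mul, sub_mul, Real.sin_add, Real.sin_sub, one_mul]
  ring

/-- Up to a constant, `∏_j sin(n_j π x_j)` is zero or one of the eigenfunctions. -/
theorem exists_sinProd_eq {d : ℕ} (n : Fin d → ℤ) :
    ∃ (a : ℝ) (i : Fin d → ℕ+), ∀ x, sinProd n x = a * eigFun i x := by
  by_cases hn : ∃ j, n j = 0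
  · obtain ⟨j, hj⟩ := hn
    exact ⟨0, fun _ => 1, fun x => by
      rw [zero_mul]
      exact Finset.prod_eq_zero (Finset.mem_univ j) (by simp [hj])⟩
  · push Not at hn
    refine ⟨((2 : ℝ) ^ ((d : ℝ) / 2))⁻¹ * ∏ j, ((n j).sign : ℝ),
      fun j => ⟨(n j).natAbs, Int.natAbs_pos.2 (hn j)⟩, fun x => ?_⟩
    have h2 : ((2 : ℝ) ^ ((d : ℝ) / 2)) ≠ 0 := by positivity
    unfold sinProd eigFun
    rw [mul_mul_mul_comm, inv_mul_cancel₀ h2, one_mul, ← Finset.prod_mul_distrib]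
    refine Finset.prod_congr rfl fun j _ => ?_
    simp only [PNat.mk_coe]
    rcases (n j).natAbs_eq with h | h
    · rw [Int.sign_eq_one_of_pos (by have := hn j; omega)]
      nth_rw 1 [h]
      simp
    · rw [Int.sign_eq_neg_one_of_neg (by have := hn j; omega)]
      nth_rw 1 [h]
      simp

variable {d : ℕ}

/-- The coordinatewise projection onto the closed cube. -/
def clamp (x : EuclideanSpace ℝ (Fin d)) : Fin d → Icc (0 : ℝ) 1 :=
  fun i => projIcc 0 1 zero_le_one (x i)

theorem continuous_clamp : Continuous (clamp (d := d)) :=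
  continuous_pi fun i => continuous_projIcc.comp (by fun_prop)

theorem clamp_apply {x : EuclideanSpace ℝ (Fin d)} (hx : x ∈ cube d) (i : Fin d) :
    (clamp x i : ℝ) = x i := by
  rw [clamp, projIcc_of_mem _ (Ioo_subset_Icc_self (hx i))]

theorem integrable_mul_sinProd (v : HSp d) (n : Fin d → ℤ) :
    Integrable (fun x => v x * sinProd n x) (cubeMeasure d) :=
  ((Lp.memLp v).integrable (by norm_num)).mul_bdd (c := 1)
    (continuous_sinProd n).aestronglyMeasurable (Filter.Eventually.of_forall (abs_sinProd_le n))

theorem integrable_mul_comp_clamp {w : EuclideanSpace ℝ (Fin d) → ℝ}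
    (hw : Integrable w (cubeMeasure d)) (f : C(Fin d → Icc (0 : ℝ) 1, ℝ)) :
    Integrable (fun x => w x * f (clamp x)) (cubeMeasure d) :=
  hw.mul_bdd (c := ‖f‖) (f.continuous.comp continuous_clamp).aestronglyMeasurable
    (Filter.Eventually.of_forall fun _ => f.norm_coe_le_norm _)

/-- Integration of `w` against continuous functions on the closed cube. -/
def pairing (w : EuclideanSpace ℝ (Fin d) → ℝ) (hw : Integrable w (cubeMeasure d)) :
    C(Fin d → Icc (0 : ℝ) 1, ℝ) →L[ℝ] ℝ :=
  LinearMap.mkContinuous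
    { toFun := fun f => ∫ x, w x * f (clamp x) ∂cubeMeasure d
      map_add' := fun f g => by
        rw [← integral_add (integrable_mul_comp_clamp hw f) (integrable_mul_comp_clamp hw g)]
        simp only [ContinuousMap.add_apply, mul_add]
      map_smul' := fun r f => by
        simp only [RingHom.id_apply, smul_eq_mul]
        rw [← integral_const_mul]
        simp only [ContinuousMap.smul_apply, smul_eq_mul, mul_left_comm] }
    (∫ x, ‖w x‖ ∂cubeMeasure d) fun f => by
      refine (norm_integral_le_integral_norm _).trans ?_
      rw [← integral_mul_const]
      refine integral_mono (integrable_mul_comp_clamp hw f).norm (hw.norm.mul_const _) fun x => ?_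
      rw [norm_mul]
      exact mul_le_mul_of_nonneg_left (f.norm_coe_le_norm _) (norm_nonneg _)

theorem pairing_apply (w : EuclideanSpace ℝ (Fin d) → ℝ) (hw : Integrable w (cubeMeasure d))
    (f : C(Fin d → Icc (0 : ℝ) 1, ℝ)) :
    pairing w hw f = ∫ x, w x * f (clamp x) ∂cubeMeasure d := rfl

/-- The function `cos(π x_l)` on the closed cube. -/
def cosCoord (l : Fin d) : C(Fin d → Icc (0 : ℝ) 1, ℝ) where
  toFun t := Real.cos (Real.pi * t l)
  continuous_toFun := by fun_prop

/-- cos is injective on [0, π], so points that differ in a coordinate are separated by the generator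
of that coordinate. -/
theorem separatesPoints_adjoin_cosCoord :
    (Algebra.adjoin ℝ (range (cosCoord (d := d)))).SeparatesPoints := by
  intro s t hst
  obtain ⟨l, hl⟩ := Function.ne_iff.1 hst
  refine ⟨cosCoord l, ⟨cosCoord l, Algebra.subset_adjoin ⟨l, rfl⟩, rfl⟩, fun h => hl ?_⟩
  have hmem : ∀ a : Icc (0 : ℝ) 1, Real.pi * a ∈ Icc 0 Real.pi := fun a =>
    ⟨mul_nonneg Real.pi_pos.le a.2.1, mul_le_of_le_one_right Real.pi_pos.le a.2.2⟩
  exact Subtype.ext (mul_left_cancel₀ Real.pi_ne_zero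
    (Real.injOn_cos (hmem (s l)) (hmem (t l)) h))

/-- The f annihilated by the pairings for all n contain 1, by orthogonality to the eigenfunctions,
and are stable under multiplication by each cos(π x_l), which only shifts n. They therefore contain
the algebra generated by the cosines, which is dense by Stone–Weierstrass, and each pairing is
continuous. -/
theorem pairing_eq_zero {v : HSp d} (hv : ∀ i, inner ℝ (eig i) v = 0) (n : Fin d → ℤ)
    (f : C(Fin d → Icc (0 : ℝ) 1, ℝ)) :
    pairing (fun x => v x * sinProd n x) (integrable_mul_sinProd v n) f = 0 := by
  set L : (Fin d → ℤ) → C(Fin d → Icc (0 : ℝ) 1, ℝ) →L[ℝ] ℝ := fun n =>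
    pairing (fun x => v x * sinProd n x) (integrable_mul_sinProd v n) with hL
  have hone : ∀ n, L n 1 = 0 := fun n => by
    obtain ⟨a, i, hai⟩ := exists_sinProd_eq n
    have h := hv i
    rw [L2.inner_def] at h
    have : L n 1 = ∫ x, a * inner ℝ (eig i x) (v x) ∂cubeMeasure d := by
      rw [hL, pairing_apply]
      refine integral_congr_ae ?_
      filter_upwards [(memLp_eigFun i).coeFn_toLp] with x hx
      rw [eig, hx, hai, ContinuousMap.one_apply, mul_one, RCLike.inner_apply]
      simp only [conj_trivial]
      ring
    rw [this, integral_const_mul, h, mul_zero]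
  have hcos : ∀ l f, (∀ n, L n f = 0) → ∀ n, L n (cosCoord l * f) = 0 := by
    intro l f hf n
    have : L n (cosCoord l * f) = 1 / 2 * (L (Function.update n l (n l + 1)) f
        + L (Function.update n l (n l - 1)) f) := by
      simp only [hL, pairing_apply]
      rw [← integral_add (integrable_mul_comp_clamp (integrable_mul_sinProd v _) f)
        (integrable_mul_comp_clamp (integrable_mul_sinProd v _) f), ← integral_const_mul]
      refine setIntegral_congr_fun (measurableSet_cube d) fun x hx => ?_
      have h := sinProd_mul_cos n l x
      have hc : cosCoord l (clamp x) = Real.cos (Real.pi * x l) := by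
        rw [← clamp_apply hx l]; rfl
      simp only [ContinuousMap.mul_apply, hc]
      linear_combination (v x * f (clamp x)) * h
    rw [this, hf, hf, add_zero, mul_zero]
  -- The induction carries all f and all n: products need a varying f, and cosines change n.
  have hadj : ∀ p ∈ Algebra.adjoin ℝ (range (cosCoord (d := d))),
      ∀ f, (∀ n, L n f = 0) → ∀ n, L n (p * f) = 0 := by
    intro p hp
    induction hp using Algebra.adjoin_induction with
    | mem p hp => obtain ⟨l, rfl⟩ := hp; exact hcos l
    | algebraMap r =>
      intro f hf n
      rw [← Algebra.smul_def, map_smul, hf, smul_zero]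
    | add p q _ _ hp hq =>
      intro f hf n
      rw [add_mul, map_add, hp f hf, hq f hf, add_zero]
    | mul p q _ _ hp hq =>
      intro f hf n
      rw [mul_assoc]
      exact hp _ (hq f hf) n
  have hclosed : IsClosed {f | L n f = 0} := isClosed_eq (L n).continuous continuous_const
  have hf : f ∈ (Algebra.adjoin ℝ (range (cosCoord (d := d)))).topologicalClosure := by
    rw [ContinuousMap.subalgebra_topologicalClosure_eq_top_of_separatesPoints _
      separatesPoints_adjoin_cosCoord]
    trivial
  refine closure_minimal (fun p hp => ?_) hclosed hf
  simpa using hadj p hp 1 hone n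

/-- The weight ∏ sin(π x_j) is strictly positive on the open cube. Its product with v annihilates
every test function, hence vanishes almost everywhere, and the weight can be divided out. -/
theorem eq_zero_of_inner_eig_eq_zero {v : HSp d} (hv : ∀ i, inner ℝ (eig i) v = 0) : v = 0 := by
  have hint := integrable_mul_sinProd v fun _ => 1
  have hae := (isOpen_cube d).ae_eq_zero_of_integral_contDiff_smul_eq_zero
    (f := fun x => v x * sinProd (fun _ => 1) x) (μ := volume)
    (IntegrableOn.locallyIntegrableOn hint) fun g hg _ hsupp => by
      have h := pairing_eq_zero hv (fun _ => 1)
        ⟨fun t => g (WithLp.toLp 2 fun i => (t i : ℝ)), hg.continuous.comp (by fun_prop)⟩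
      rw [pairing_apply] at h
      rw [← setIntegral_eq_integral_of_forall_compl_eq_zero (s := cube d) fun x hx => by
        rw [image_eq_zero_of_notMem_tsupport fun hx' => hx (hsupp hx'), zero_smul], ← h]
      refine setIntegral_congr_fun (measurableSet_cube d) fun x hx => ?_
      have hx' : (WithLp.toLp 2 fun i => (clamp x i : ℝ)) = x := by
        ext i
        exact clamp_apply hx i
      simp only [ContinuousMap.coe_mk, hx', smul_eq_mul]
      ring
  refine (Lp.eq_zero_iff_ae_eq_zero).2 ?_
  rw [Filter.EventuallyEq, ae_restrict_iff' (measurableSet_cube d)]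
  filter_upwards [hae] with x h hx
  refine (mul_eq_zero.1 (h hx)).resolve_right (Finset.prod_pos fun j _ => ?_).ne'
  refine Real.sin_pos_of_pos_of_lt_pi ?_ ?_
  · have := (hx j).1
    have := Real.pi_pos
    simp only [Int.cast_one, one_mul]
    positivity
  · have := (hx j).2
    simpa using mul_lt_of_lt_one_right Real.pi_pos this

/-- The eigenfunctions of the Dirichlet Laplacian form a Hilbert basis. -/
def eigBasis (d : ℕ) : HilbertBasis (Fin d → ℕ+) ℝ (HSp d) :=
  HilbertBasis.mkOfOrthogonalEqBot (orthonormal_eig d) <| by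
    rw [Submodule.eq_bot_iff]
    intro v hv
    exact eq_zero_of_inner_eig_eq_zero fun i =>
      (Submodule.mem_orthogonal _ _).1 hv _ (Submodule.subset_span ⟨i, rfl⟩)

theorem eigBasis_apply (i : Fin d → ℕ+) : eigBasis d i = eig i := by
  rw [eigBasis, HilbertBasis.coe_mkOfOrthogonalEqBot]

end Completeness

/-! ### The Sobolev embedding `V_{d/5} ⊆ L⁴` -/

section Convolution

/-- A weighted Cauchy–Schwarz bound for the self-convolution of a finite sequence. -/
theorem sum_convolution_sq_le {ι : Type*} [DecidableEq ι] [Add ι] [IsLeftCancelAdd ι]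
    [IsRightCancelAdd ι] (S : Finset ι)
    (a r : ι → ℝ) (hr : ∀ i, 0 < r i) {W : ℝ} (hW : ∑ i ∈ S, (r i)⁻¹ ^ 2 ≤ W) :
    ∑ k ∈ (S ×ˢ S).image (fun p => p.1 + p.2),
      (∑ p ∈ S ×ˢ S with p.1 + p.2 = k, a p.1 * a p.2) ^ 2
      ≤ W * (∑ i ∈ S, r i * a i ^ 2) ^ 2 := by
  -- On the fibre p.1 + p.2 = k each coordinate determines the other by cancellation, so ∑ r⁻² over
  -- either coordinate is at most W; AM–GM then bounds the mixed sum.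
  have hfib : ∀ k, ∑ p ∈ S ×ˢ S with p.1 + p.2 = k, (r p.1)⁻¹ * (r p.2)⁻¹ ≤ W := by
    intro k
    have h1 : ∑ p ∈ S ×ˢ S with p.1 + p.2 = k, (r p.1)⁻¹ ^ 2 ≤ W := by
      rw [← Finset.sum_image (f := fun i => (r i)⁻¹ ^ 2) (g := Prod.fst)]
      · refine (Finset.sum_le_sum_of_subset_of_nonneg ?_ fun _ _ _ => by positivity).trans hW
        intro i hi
        obtain ⟨p, hp, rfl⟩ := Finset.mem_image.1 hi
        exact (Finset.mem_product.1 (Finset.mem_filter.1 hp).1).1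
      · intro p hp q hq hpq
        simp only [Finset.coe_filter, mem_ofPred_eq] at hp hq
        have h := hp.2.trans hq.2.symm
        rw [hpq] at h
        exact Prod.ext hpq (add_left_cancel h)
    have h2 : ∑ p ∈ S ×ˢ S with p.1 + p.2 = k, (r p.2)⁻¹ ^ 2 ≤ W := by
      rw [← Finset.sum_image (f := fun i => (r i)⁻¹ ^ 2) (g := Prod.snd)]
      · refine (Finset.sum_le_sum_of_subset_of_nonneg ?_ fun _ _ _ => by positivity).trans hW
        intro i hi
        obtain ⟨p, hp, rfl⟩ := Finset.mem_image.1 hi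
        exact (Finset.mem_product.1 (Finset.mem_filter.1 hp).1).2
      · intro p hp q hq hpq
        simp only [Finset.coe_filter, mem_ofPred_eq] at hp hq
        have h := hp.2.trans hq.2.symm
        rw [hpq] at h
        exact Prod.ext (add_right_cancel h) hpq
    have h3 : ∑ p ∈ S ×ˢ S with p.1 + p.2 = k, (r p.1)⁻¹ * (r p.2)⁻¹
        ≤ ∑ p ∈ S ×ˢ S with p.1 + p.2 = k, ((r p.1)⁻¹ ^ 2 + (r p.2)⁻¹ ^ 2) / 2 :=
      Finset.sum_le_sum fun p _ => by nlinarith [sq_nonneg ((r p.1)⁻¹ - (r p.2)⁻¹)]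
    rw [← Finset.sum_div, Finset.sum_add_distrib] at h3
    linarith
  -- Cauchy–Schwarz with the weight r p.1 * r p.2 and its inverse.
  have hcs : ∀ k, (∑ p ∈ S ×ˢ S with p.1 + p.2 = k, a p.1 * a p.2) ^ 2
      ≤ W * ∑ p ∈ S ×ˢ S with p.1 + p.2 = k, r p.1 * a p.1 ^ 2 * (r p.2 * a p.2 ^ 2) := by
    intro k
    have hnn : ∀ p ∈ (S ×ˢ S).filter (fun p => p.1 + p.2 = k),
        0 ≤ r p.1 * a p.1 ^ 2 * (r p.2 * a p.2 ^ 2) := fun p _ => by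
      have := hr p.1; have := hr p.2; positivity
    refine (Finset.sum_sq_le_sum_mul_sum_of_sq_le_mul _ hnn
      (g := fun p => (r p.1)⁻¹ * (r p.2)⁻¹) (fun p _ => ?_) fun p _ => ?_).trans ?_
    · have := hr p.1; have := hr p.2; positivity
    · have := (hr p.1).ne'; have := (hr p.2).ne'
      refine le_of_eq ?_
      field_simp
    · rw [mul_comm]
      exact mul_le_mul_of_nonneg_right (hfib k) (Finset.sum_nonneg hnn)
  refine (Finset.sum_le_sum fun k _ => hcs k).trans_eq ?_
  rw [← Finset.mul_sum, Finset.sum_fiberwise_of_maps_to fun p hp => Finset.mem_image_of_mem _ hp,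
    sq, Finset.sum_mul_sum, Finset.sum_product]

end Convolution

/-! ### Exponential sums and their fourth moments -/

section Characters

variable {d : ℕ}

/-- The character `x ↦ exp(iπ n·x)`. -/
def char (n : Fin d → ℤ) (x : EuclideanSpace ℝ (Fin d)) : ℂ :=
  ∏ j, Complex.exp (Complex.I * Real.pi * n j * x j)

theorem continuous_char (n : Fin d → ℤ) : Continuous (char n) := by
  unfold char
  fun_prop

theorem char_add (m n : Fin d → ℤ) (x : EuclideanSpace ℝ (Fin d)) :
    char (m + n) x = char m x * char n x := by
  rw [char, char, char, ← Finset.prod_mul_distrib]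
  refine Finset.prod_congr rfl fun j _ => ?_
  rw [← Complex.exp_add, Pi.add_apply]
  push_cast
  ring_nf

theorem conj_char (n : Fin d → ℤ) (x : EuclideanSpace ℝ (Fin d)) :
    (starRingEnd ℂ) (char n x) = char (-n) x := by
  rw [char, char, map_prod]
  refine Finset.prod_congr rfl fun j _ => ?_
  rw [← Complex.exp_conj]
  simp

/-- The cube `(-1,1)^d`. -/
def box (d : ℕ) : Set (EuclideanSpace ℝ (Fin d)) := {x | ∀ i, x i ∈ Ioo (-1 : ℝ) 1}

theorem cube_subset_box : cube d ⊆ box d :=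
  fun _ hx i => ⟨by linarith [(hx i).1], (hx i).2⟩

theorem integrableOn_box {E : Type*} [NormedAddCommGroup E] {f : EuclideanSpace ℝ (Fin d) → E}
    (hf : Continuous f) : IntegrableOn f (box d) := by
  refine (hf.continuousOn.integrableOn_compact
    (isCompact_closedBall (0 : EuclideanSpace ℝ (Fin d)) (Real.sqrt d))).mono_set fun x hx => ?_
  rw [mem_closedBall_zero_iff, EuclideanSpace.norm_eq]
  refine Real.sqrt_le_sqrt ?_
  calc ∑ i, ‖x i‖ ^ 2 ≤ ∑ _i : Fin d, (1 : ℝ) := by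
        refine Finset.sum_le_sum fun i _ => ?_
        have := hx i
        rw [Real.norm_eq_abs, sq_abs]
        nlinarith [this.1, this.2]
    _ = d := by simp

/-- The characters exp(iπny) have period 2, so their orthogonality holds on (-1,1) and not on (0,1).
-/
theorem integral_exp_int (n : ℤ) :
    ∫ y in Ioo (-1 : ℝ) 1, Complex.exp (Complex.I * Real.pi * n * y) = if n = 0 then 2 else 0 := by
  rw [← integral_Ioc_eq_integral_Ioo, ← intervalIntegral.integral_of_le (by norm_num)]
  split_ifs with hn
  · simp [hn]; norm_num
  · have hn' : Complex.I * Real.pi * n ≠ 0 := by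
      simp [hn, Real.pi_ne_zero]
    rw [integral_exp_mul_complex hn', div_eq_zero_iff, sub_eq_zero]
    left
    rw [Complex.exp_eq_exp_iff_exists_int]
    exact ⟨n, by push_cast; ring⟩

theorem integral_char (n : Fin d → ℤ) :
    ∫ x in box d, char n x = if n = 0 then 2 ^ d else 0 := by
  refine (setIntegral_box_prod (Ioo (-1) 1) fun j y =>
    Complex.exp (Complex.I * Real.pi * n j * y)).trans ?_
  simp_rw [integral_exp_int]
  split_ifs with h
  · simp [h]
  · obtain ⟨l, hl⟩ := Function.ne_iff.1 h
    exact Finset.prod_eq_zero (Finset.mem_univ l) (if_neg hl)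

/-- Parseval's identity for finite sums of distinct characters. -/
theorem integral_norm_sum_char_sq {ι : Type*} (K : Finset ι) (B : ι → ℝ) (n : ι → Fin d → ℤ)
    (hn : Function.Injective n) :
    ∫ x in box d, ‖∑ k ∈ K, (B k : ℂ) * char (n k) x‖ ^ 2 = 2 ^ d * ∑ k ∈ K, B k ^ 2 := by
  classical
  have h1 : ∀ x, ((‖∑ k ∈ K, (B k : ℂ) * char (n k) x‖ ^ 2 : ℝ) : ℂ)
      = ∑ k ∈ K, ∑ l ∈ K, (B k * B l : ℂ) * char (n k - n l) x := fun x => by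
    rw [Complex.ofReal_pow, ← Complex.mul_conj', map_sum, Finset.sum_mul_sum]
    refine Finset.sum_congr rfl fun k _ => Finset.sum_congr rfl fun l _ => ?_
    rw [map_mul, Complex.conj_ofReal, conj_char, sub_eq_add_neg, char_add]
    ring
  have hint : ∀ k l, IntegrableOn (fun x => (B k * B l : ℂ) * char (n k - n l) x) (box d) :=
    fun k l => integrableOn_box (continuous_const.mul (continuous_char _))
  rw [← Complex.ofReal_inj, ← integral_complex_ofReal]
  simp_rw [h1]
  rw [integral_finsetSum _ fun k _ => integrable_finsetSum _ fun l _ => hint k l]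
  push_cast
  rw [Finset.mul_sum]
  refine Finset.sum_congr rfl fun k hk => ?_
  rw [integral_finsetSum _ fun l _ => hint k l]
  simp_rw [integral_const_mul, integral_char, sub_eq_zero, hn.eq_iff]
  rw [Finset.sum_eq_single k (fun l _ hl => by rw [if_neg hl.symm, mul_zero])
    fun h => absurd hk h, if_pos rfl]
  ring

/-- The frequency `(± i_j)_j`. -/
def signed (p : Fin d → Bool) (i : Fin d → ℕ+) (j : Fin d) : ℤ :=
  if p j then (i j : ℤ) else -(i j : ℤ)

theorem signed_injective (p : Fin d → Bool) : Function.Injective (signed p) := by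
  intro i i' h
  funext j
  have hj := congrFun h j
  unfold signed at hj
  split_ifs at hj
  · exact_mod_cast hj
  · exact_mod_cast neg_injective hj

/-- For a fixed sign pattern the frequency map is additive as well as injective, so squaring a sum
of characters convolves the coefficients along the index set itself. -/
theorem signed_add (p : Fin d → Bool) (i i' : Fin d → ℕ+) :
    signed p (i + i') = signed p i + signed p i' := by
  funext j
  simp only [signed, Pi.add_apply]
  split_ifs <;> push_cast <;> ring

/-- The fourth moment of a finite sum of characters. -/
theorem integral_norm_sum_char_pow_four_le (p : Fin d → Bool) (S : Finset (Fin d → ℕ+))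
    (a r : (Fin d → ℕ+) → ℝ) (hr : ∀ i, 0 < r i) {W : ℝ} (hW : ∑ i ∈ S, (r i)⁻¹ ^ 2 ≤ W) :
    ∫ x in box d, ‖∑ i ∈ S, (a i : ℂ) * char (signed p i) x‖ ^ 4
      ≤ 2 ^ d * (W * (∑ i ∈ S, r i * a i ^ 2) ^ 2) := by
  classical
  have hsq : ∀ x, ‖∑ i ∈ S, (a i : ℂ) * char (signed p i) x‖ ^ 4
      = ‖∑ k ∈ (S ×ˢ S).image (fun q => q.1 + q.2),
        ((∑ q ∈ S ×ˢ S with q.1 + q.2 = k, a q.1 * a q.2 : ℝ) : ℂ) * char (signed p k) x‖ ^ 2 := by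
    intro x
    rw [show 4 = 2 * 2 from rfl, pow_mul, ← norm_pow]
    congr 2
    rw [sq, Finset.sum_mul_sum, ← Finset.sum_product', ← Finset.sum_fiberwise_of_maps_to
      (g := fun q : (Fin d → ℕ+) × (Fin d → ℕ+) => q.1 + q.2)
      (fun q hq => Finset.mem_image_of_mem _ hq)]
    refine Finset.sum_congr rfl fun k _ => ?_
    push_cast
    rw [Finset.sum_mul]
    refine Finset.sum_congr rfl fun q hq => ?_
    rw [← (Finset.mem_filter.1 hq).2, signed_add, char_add]
    ring
  simp_rw [hsq]
  rw [integral_norm_sum_char_sq _ _ _ (signed_injective p)]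
  gcongr
  exact sum_convolution_sq_le S a r hr hW

/-- An eigenfunction is a combination of characters with coefficients of modulus at most one. -/
theorem exists_eigFun_eq_sum_char :
    ∃ C : (Fin d → Bool) → ℂ, (∀ p, ‖C p‖ ≤ 1) ∧ ∀ (i : Fin d → ℕ+) x,
      (eigFun i x : ℂ) = ∑ p, C p * char (signed p i) x := by
  -- These are the coefficients of sin θ = (e^{iθ} − e^{-iθ})/(2i). A product of d of them has
  -- modulus 2^{-d}, which absorbs the factor 2^{d/2}.
  let b : Bool → ℂ := fun s => if s then -(Complex.I / 2) else Complex.I / 2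
  have hb : ∀ s, ‖b s‖ = 1 / 2 := fun s => by
    cases s <;> simp [b]
  refine ⟨fun p => ((2 : ℝ) ^ ((d : ℝ) / 2) : ℝ) * ∏ j, b (p j), fun p => ?_, fun i x => ?_⟩
  · rw [norm_mul, norm_prod, Complex.norm_of_nonneg (by positivity)]
    simp_rw [hb]
    rw [Finset.prod_const, Finset.card_univ, Fintype.card_fin, one_div, inv_pow,
      mul_inv_le_iff₀ (by positivity), one_mul, ← Real.rpow_natCast]
    exact Real.rpow_le_rpow_of_exponent_le one_le_two (half_le_self (by positivity))
  · have hsin : ∀ j, ((Real.sin ((i j : ℕ) * Real.pi * x j) : ℝ) : ℂ)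
        = ∑ s : Bool, b s * Complex.exp (Complex.I * Real.pi
          * ((if s then (i j : ℤ) else -(i j : ℤ) : ℤ) : ℂ) * x j) := fun j => by
      rw [Fintype.sum_bool, Complex.ofReal_sin, Complex.sin]
      simp only [b, if_true, Bool.false_eq_true, if_false]
      push_cast
      ring_nf
    rw [eigFun]
    push_cast
    have hprod := Finset.prod_congr rfl fun j (_ : j ∈ (Finset.univ : Finset (Fin d))) => hsin j
    push_cast at hprod
    rw [hprod, Finset.prod_univ_sum, Fintype.piFinset_univ, Finset.mul_sum]
    refine Finset.sum_congr rfl fun p _ => ?_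
    rw [Finset.prod_mul_distrib, ← mul_assoc]
    congr 1
    refine Finset.prod_congr rfl fun j _ => ?_
    rw [signed]
    push_cast
    rfl

/-- The fourth moment of a finite sum of eigenfunctions. -/
theorem integral_sum_eigFun_pow_four_le (S : Finset (Fin d → ℕ+))
    (a r : (Fin d → ℕ+) → ℝ) (hr : ∀ i, 0 < r i) {W : ℝ} (hW : ∑ i ∈ S, (r i)⁻¹ ^ 2 ≤ W) :
    ∫ x in cube d, |∑ i ∈ S, a i * eigFun i x| ^ 4
      ≤ (2 ^ d) ^ 5 * W * (∑ i ∈ S, r i * a i ^ 2) ^ 2 := by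
  obtain ⟨C, hC, heig⟩ := exists_eigFun_eq_sum_char (d := d)
  set F : (Fin d → Bool) → EuclideanSpace ℝ (Fin d) → ℂ :=
    fun p x => ∑ i ∈ S, (a i : ℂ) * char (signed p i) x with hF
  have hFc : ∀ p, Continuous (F p) := fun p =>
    continuous_finsetSum _ fun i _ => continuous_const.mul (continuous_char _)
  -- The power mean inequality over the 2^d sign patterns costs (2^d)³. Summing over the patterns
  -- and the volume 2^d of the box supply the other two factors of (2^d)^5.
  have hpt : ∀ x, |∑ i ∈ S, a i * eigFun i x| ^ 4 ≤ (2 ^ d) ^ 3 * ∑ p, ‖F p x‖ ^ 4 := by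
    intro x
    have h1 : ((∑ i ∈ S, a i * eigFun i x : ℝ) : ℂ) = ∑ p, C p * F p x := by
      push_cast
      simp_rw [heig, hF, Finset.mul_sum]
      rw [Finset.sum_comm]
      exact Finset.sum_congr rfl fun p _ => Finset.sum_congr rfl fun i _ => by ring
    have h2 : |∑ i ∈ S, a i * eigFun i x| ≤ ∑ p, ‖F p x‖ := by
      rw [← Real.norm_eq_abs, ← Complex.norm_real, h1]
      refine (norm_sum_le _ _).trans (Finset.sum_le_sum fun p _ => ?_)
      rw [norm_mul]
      exact mul_le_of_le_one_left (norm_nonneg _) (hC p)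
    have h3 := pow_sum_div_card_le_sum_pow (s := Finset.univ) (f := fun p => ‖F p x‖)
      (fun p _ => norm_nonneg _) 3
    rw [Finset.card_univ, Fintype.card_pi, div_le_iff₀' (by simp)] at h3
    simp only [Fintype.card_bool, Finset.prod_const, Finset.card_univ, Fintype.card_fin,
      Nat.cast_pow, Nat.cast_ofNat] at h3
    exact (pow_le_pow_left₀ (abs_nonneg _) h2 4).trans h3
  have hint : ∀ p, IntegrableOn (fun x => ‖F p x‖ ^ 4) (box d) := fun p =>
    integrableOn_box ((hFc p).norm.pow 4)
  have hcont : Continuous fun x : EuclideanSpace ℝ (Fin d) => |∑ i ∈ S, a i * eigFun i x| ^ 4 := by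
    unfold eigFun
    fun_prop
  calc ∫ x in cube d, |∑ i ∈ S, a i * eigFun i x| ^ 4
      ≤ ∫ x in box d, |∑ i ∈ S, a i * eigFun i x| ^ 4 :=
        setIntegral_mono_set (integrableOn_box hcont)
          (Filter.Eventually.of_forall fun _ => by positivity) cube_subset_box.eventuallyLE
    _ ≤ ∫ x in box d, (2 ^ d) ^ 3 * ∑ p, ‖F p x‖ ^ 4 :=
        integral_mono (integrableOn_box hcont)
          ((integrable_finsetSum _ fun p _ => hint p).const_mul _) hpt
    _ = (2 ^ d) ^ 3 * ∑ p, ∫ x in box d, ‖F p x‖ ^ 4 := by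
        rw [integral_const_mul, integral_finsetSum _ fun p _ => hint p]
    _ ≤ (2 ^ d) ^ 3 * ∑ _p : Fin d → Bool, 2 ^ d * (W * (∑ i ∈ S, r i * a i ^ 2) ^ 2) := by
        gcongr with p
        exact integral_norm_sum_char_pow_four_le p S a r hr hW
    _ = _ := by
        rw [Finset.sum_const, Finset.card_univ, Fintype.card_pi]
        simp only [Fintype.card_bool, Finset.prod_const, Finset.card_univ, Fintype.card_fin,
          nsmul_eq_mul, Nat.cast_pow, Nat.cast_ofNat]
        ring

end Characters

/-! ### Summability of the eigenvalue powers and passage to the limit -/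

section Embedding

variable {d : ℕ} {k : ℝ}

theorem eigVal_pos (hd : 1 ≤ d) (hk : 0 < k) (i : Fin d → ℕ+) : 0 < eigVal k i := by
  have : Nonempty (Fin d) := ⟨⟨0, hd⟩⟩
  refine mul_pos (by positivity) (Finset.sum_pos (fun j _ => ?_) Finset.univ_nonempty)
  have : 0 < ((i j : ℕ) : ℝ) := by exact_mod_cast (i j).pos
  positivity

/-- Each i_j² is at most s = ∑ i_j², so ∏ i_j² ≤ s^d; raising this to the power −4/5 decouples the
coordinates. The exponent −8/5 < −1 makes each one-dimensional sum converge. -/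
theorem eigVal_rpow_le (hd : 1 ≤ d) (hk : 0 < k) (i : Fin d → ℕ+) :
    ((eigVal k i ^ ((d : ℝ) / 5)) ^ 2)⁻¹ ^ 2
      ≤ (k * Real.pi ^ 2) ^ (-(4 * (d : ℝ) / 5)) * ∏ j, ((i j : ℕ) : ℝ) ^ (-(8 / 5) : ℝ) := by
  have hpos := eigVal_pos hd hk i
  have hi : ∀ j, 0 < ((i j : ℕ) : ℝ) := fun j => by exact_mod_cast (i j).pos
  have hkp : 0 < k * Real.pi ^ 2 := by positivity
  set s := ∑ j, ((i j : ℕ) : ℝ) ^ 2 with hs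
  have hspos : 0 < s := by
    rw [eigVal] at hpos
    exact (mul_pos_iff_of_pos_left hkp).1 hpos
  have h1 : ((eigVal k i ^ ((d : ℝ) / 5)) ^ 2)⁻¹ ^ 2 = eigVal k i ^ (-(4 * (d : ℝ) / 5)) := by
    rw [inv_pow, ← pow_mul, ← Real.rpow_natCast, ← Real.rpow_mul hpos.le, ← Real.rpow_neg hpos.le]
    congr 1
    push_cast
    ring
  rw [h1, eigVal, Real.mul_rpow hkp.le hspos.le]
  gcongr
  have h2 : ∏ j, ((i j : ℕ) : ℝ) ^ 2 ≤ s ^ d := by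
    refine (Finset.prod_le_prod (fun j _ => by positivity) fun j hj =>
      Finset.single_le_sum (f := fun j => ((i j : ℕ) : ℝ) ^ 2) (fun j _ => by positivity)
        hj).trans_eq ?_
    rw [Finset.prod_const, Finset.card_univ, Fintype.card_fin]
  calc s ^ (-(4 * (d : ℝ) / 5)) = (s ^ d) ^ (-(4 / 5) : ℝ) := by
        rw [← Real.rpow_natCast, ← Real.rpow_mul hspos.le]
        congr 1
        ring
    _ ≤ (∏ j, ((i j : ℕ) : ℝ) ^ 2) ^ (-(4 / 5) : ℝ) :=
        Real.rpow_le_rpow_of_nonpos (Finset.prod_pos fun j _ => pow_pos (hi j) 2) h2 (by norm_num)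
    _ = ∏ j, ((i j : ℕ) : ℝ) ^ (-(8 / 5) : ℝ) := by
        rw [← Real.finsetProd_rpow _ _ fun j _ => by positivity]
        refine Finset.prod_congr rfl fun j _ => ?_
        rw [← Real.rpow_natCast, ← Real.rpow_mul (hi j).le]
        norm_num

theorem exists_sum_eigVal_le (hd : 1 ≤ d) (hk : 0 < k) :
    ∃ W : ℝ, 0 ≤ W ∧ ∀ S : Finset (Fin d → ℕ+),
      ∑ i ∈ S, ((eigVal k i ^ ((d : ℝ) / 5)) ^ 2)⁻¹ ^ 2 ≤ W := by
  classical
  have hsum : Summable fun n : ℕ+ => ((n : ℕ) : ℝ) ^ (-(8 / 5) : ℝ) :=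
    (Real.summable_nat_rpow.2 (by norm_num)).comp_injective PNat.coe_injective
  have hkp : 0 < k * Real.pi ^ 2 := by positivity
  refine ⟨(k * Real.pi ^ 2) ^ (-(4 * (d : ℝ) / 5))
    * (∑' n : ℕ+, ((n : ℕ) : ℝ) ^ (-(8 / 5) : ℝ)) ^ d, ?_, fun S => ?_⟩
  · have : 0 ≤ ∑' n : ℕ+, ((n : ℕ) : ℝ) ^ (-(8 / 5) : ℝ) := tsum_nonneg fun n => by positivity
    positivity
  · refine (Finset.sum_le_sum fun i _ => eigVal_rpow_le hd hk i).trans ?_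
    rw [← Finset.mul_sum]
    gcongr
    -- Enclosing S in the product of its projections lets the sum factor.
    let P : Fin d → Finset ℕ+ := fun j => S.image fun i => i j
    calc ∑ i ∈ S, ∏ j, ((i j : ℕ) : ℝ) ^ (-(8 / 5) : ℝ)
        ≤ ∑ i ∈ Fintype.piFinset P, ∏ j, ((i j : ℕ) : ℝ) ^ (-(8 / 5) : ℝ) :=
          Finset.sum_le_sum_of_subset_of_nonneg
            (fun i hi => Fintype.mem_piFinset.2 fun j => Finset.mem_image_of_mem _ hi)
            fun i _ _ => by positivity
      _ = ∏ j, ∑ n ∈ P j, ((n : ℕ) : ℝ) ^ (-(8 / 5) : ℝ) :=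
          (Finset.prod_univ_sum P fun _ n => ((n : ℕ) : ℝ) ^ (-(8 / 5) : ℝ)).symm
      _ ≤ ∏ _j : Fin d, ∑' n : ℕ+, ((n : ℕ) : ℝ) ^ (-(8 / 5) : ℝ) :=
          Finset.prod_le_prod (fun j _ => Finset.sum_nonneg fun n _ => by positivity)
            fun j _ => hsum.sum_le_tsum _ fun n _ => by positivity
      _ = _ := by rw [Finset.prod_const, Finset.card_univ, Fintype.card_fin]

theorem VNorm_sq {r : ℝ} {v : HSp d} (hv : v ∈ VSet d k r) :
    VNorm d k r v ^ 2 = ∑' i, (eigVal k i ^ r * inner ℝ (eig i) v) ^ 2 := by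
  have hmem : Memℓp (fun i : Fin d → ℕ+ => eigVal k i ^ r * inner ℝ (eig i) v) 2 :=
    memℓp_gen (by
      simp only [ENNReal.toReal_ofNat, Real.rpow_ofNat, Real.norm_eq_abs, sq_abs]
      exact hv)
  have h1 := (eigBasis d).hasSum_repr_symm ⟨_, hmem⟩
  simp only [eigBasis_apply] at h1
  rw [VNorm, fracPow, h1.tsum_eq, LinearIsometryEquiv.norm_map]
  have h2 := lp.norm_rpow_eq_tsum (p := 2) (by norm_num)
    (⟨_, hmem⟩ : lp (fun _ : Fin d → ℕ+ => ℝ) 2)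
  simpa only [ENNReal.toReal_ofNat, Real.rpow_ofNat, Real.norm_eq_abs, sq_abs] using h2

/-- The Sobolev embedding of `V_{d/5}` into `L⁴`. -/
theorem exists_lintegral_pow_four_le (hd : 1 ≤ d) (hk : 0 < k) :
    ∃ M : ℝ, 0 ≤ M ∧ ∀ v ∈ VSet d k ((d : ℝ) / 5),
      ∫⁻ x, ‖v x‖ₑ ^ 4 ∂cubeMeasure d ≤ ENNReal.ofReal (M * VNorm d k ((d : ℝ) / 5) v ^ 4) := by
  obtain ⟨W, hW0, hW⟩ := exists_sum_eigVal_le hd hk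
  refine ⟨(2 ^ d) ^ 5 * W, by positivity, fun v hv => ?_⟩
  set β := (d : ℝ) / 5
  have hL4 : ∀ f : EuclideanSpace ℝ (Fin d) → ℝ,
      eLpNorm f 4 (cubeMeasure d) ^ (4 : ℝ) = ∫⁻ x, ‖f x‖ₑ ^ 4 ∂cubeMeasure d := fun f => by
    have h := eLpNorm_nnreal_pow_eq_lintegral (μ := cubeMeasure d) (f := f) (p := 4) (by norm_num)
    simpa using h
  set a : (Fin d → ℕ+) → ℝ := fun i => inner ℝ (eig i) v with ha
  have hsum : HasSum (fun i => a i • eig i) v := by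
    have h := (eigBasis d).hasSum_repr v
    simpa only [HilbertBasis.repr_apply_apply, eigBasis_apply] using h
  have hcoe : ∀ S : Finset (Fin d → ℕ+), ((∑ i ∈ S, a i • eig i : HSp d) : _ → ℝ)
      =ᵐ[cubeMeasure d] fun x => ∑ i ∈ S, a i * eigFun i x := fun S => by
    have hall : ∀ᵐ x ∂cubeMeasure d, ∀ i, (a i • eig i : HSp d) x = a i * eigFun i x :=
      ae_all_iff.2 fun i => by
        filter_upwards [Lp.coeFn_smul (a i) (eig i), (memLp_eigFun i).coeFn_toLp] with x h1 h2
        rw [h1, Pi.smul_apply, eig, h2, smul_eq_mul]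
    filter_upwards [Lp.coeFn_fun_finsetSum S fun i => (a i • eig i : HSp d), hall] with x h1 h2
    rw [h1]
    exact Finset.sum_congr rfl fun i _ => h2 i
  -- The weights are r_i = λ_i^{2β}, for which ∑ r_i a_i² over S is at most `VNorm d k β v ^ 2`; the
  -- bound is thus uniform in S.
  have hbound : ∀ S : Finset (Fin d → ℕ+), eLpNorm (∑ i ∈ S, a i • eig i : HSp d) 4 (cubeMeasure d)
      ≤ ENNReal.ofReal ((2 ^ d) ^ 5 * W * VNorm d k β v ^ 4) ^ (4 : ℝ)⁻¹ := fun S => by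
    rw [eLpNorm_congr_ae (hcoe S), ENNReal.le_rpow_inv_iff (by norm_num), hL4]
    have hcont : Continuous fun x : EuclideanSpace ℝ (Fin d) =>
        |∑ i ∈ S, a i * eigFun i x| ^ 4 := by
      unfold eigFun
      fun_prop
    have hlin : ∫⁻ x, ‖∑ i ∈ S, a i * eigFun i x‖ₑ ^ 4 ∂cubeMeasure d
        = ENNReal.ofReal (∫ x in cube d, |∑ i ∈ S, a i * eigFun i x| ^ 4) := by
      rw [ofReal_integral_eq_lintegral_ofReal
        ((integrableOn_box hcont).mono_set cube_subset_box)
        (Filter.Eventually.of_forall fun _ => by positivity)]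
      refine lintegral_congr fun x => ?_
      rw [ENNReal.ofReal_pow (abs_nonneg _), ← Real.norm_eq_abs, ofReal_norm]
    rw [hlin]
    refine ENNReal.ofReal_le_ofReal ((integral_sum_eigFun_pow_four_le S a
      (fun i => (eigVal k i ^ β) ^ 2) (fun i => by
        have := eigVal_pos hd hk i
        positivity) (hW S)).trans ?_)
    rw [show VNorm d k β v ^ 4 = (VNorm d k β v ^ 2) ^ 2 by ring, VNorm_sq hv]
    gcongr
    simp_rw [← mul_pow]
    exact Summable.sum_le_tsum S (fun i _ => by positivity) hv
  -- L² convergence implies convergence in measure, under which the L⁴ norm is lower semicontinuous.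
  have hv4 := eLpNorm_le_of_tendstoInMeasure (Filter.Eventually.of_forall hbound)
    (tendstoInMeasure_of_tendsto_Lp hsum) fun S => Lp.aestronglyMeasurable _
  rwa [ENNReal.le_rpow_inv_iff (by norm_num), hL4] at hv4

end Embedding

/-! ### The two estimates -/

section Estimates

variable {d : ℕ} {c : ℝ} {g : EuclideanSpace ℝ (Fin d) → ℝ → ℝ}

/-- Replacing √h by √T in the numerator makes the constant independent of h, apart from the factor
1/h. -/
theorem lintegral_fdCoeff_sub_le
    (hg : ContDiffOn ℝ 2 (fun p : EuclideanSpace ℝ (Fin d) × ℝ => g p.1 p.2) (cube d ×ˢ univ))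
    (hg1 : ∀ x ∈ cube d, ∀ y : ℝ, |deriv (g x) y| ≤ c) (hc : 0 ≤ c) (v w : HSp d) {h T : ℝ}
    (hh : 0 < h) (hhT : h ≤ T) :
    ∫⁻ x, ‖fdCoeff g v h x - fdCoeff g w h x‖ₑ ^ 2 ∂cubeMeasure d
      ≤ ENNReal.ofReal ((c * (2 + √T * c)) ^ 2 / h * ‖v - w‖ ^ 2) := by
  have hs : 0 < √h := Real.sqrt_pos.2 hh
  calc ∫⁻ x, ‖fdCoeff g v h x - fdCoeff g w h x‖ₑ ^ 2 ∂cubeMeasure d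
      ≤ ∫⁻ x, ENNReal.ofReal ((c * (2 + √T * c)) ^ 2 / h) * ‖(v - w) x‖ₑ ^ 2 ∂cubeMeasure d := by
        refine lintegral_mono_ae ?_
        filter_upwards [Lp.coeFn_sub v w, ae_restrict_mem (measurableSet_cube d)] with x hx hxc
        rw [hx, Pi.sub_apply, ← ofReal_norm, ← ofReal_norm, ← ENNReal.ofReal_pow (norm_nonneg _),
          ← ENNReal.ofReal_pow (norm_nonneg _), ← ENNReal.ofReal_mul (by positivity)]
        refine ENNReal.ofReal_le_ofReal ?_
        calc ‖fdCoeff g v h x - fdCoeff g w h x‖ ^ 2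
            ≤ (c * (2 + √T * c) / √h * |v x - w x|) ^ 2 := by
              refine pow_le_pow_left₀ (norm_nonneg _)
                ((abs_fdCoeff_sub_le hg hg1 hc v w hh hxc).trans ?_) 2
              gcongr
          _ = _ := by rw [mul_pow, div_pow, Real.sq_sqrt hh.le, Real.norm_eq_abs]
    _ = _ := by
        rw [lintegral_const_mul' _ _ ENNReal.ofReal_ne_top, ← enorm_sq_eq_lintegral,
          ENNReal.ofReal_mul (by positivity), ENNReal.ofReal_pow (norm_nonneg _), ofReal_norm]

theorem lintegral_fdCoeff_sub_milCoeff_le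
    (hg : ContDiffOn ℝ 2 (fun p : EuclideanSpace ℝ (Fin d) × ℝ => g p.1 p.2) (cube d ×ˢ univ))
    (hg0 : ∀ x ∈ cube d, |g x 0| ≤ c) (hg1 : ∀ x ∈ cube d, ∀ y : ℝ, |deriv (g x) y| ≤ c)
    (hg2 : ∀ x ∈ cube d, ∀ y : ℝ, |iteratedDeriv 2 (g x) y| ≤ c) (hc : 0 ≤ c)
    {v : HSp d} {h N : ℝ} (hh : 0 < h) (hN : 0 ≤ N)
    (hv : ∫⁻ x, ‖v x‖ₑ ^ 4 ∂cubeMeasure d ≤ ENNReal.ofReal N) :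
    ∫⁻ x, ‖fdCoeff g v h x - milCoeff g v x‖ₑ ^ 2 ∂cubeMeasure d
      ≤ ENNReal.ofReal (8 * c ^ 6 * h * ((cubeMeasure d).real univ + N)) := by
  calc ∫⁻ x, ‖fdCoeff g v h x - milCoeff g v x‖ₑ ^ 2 ∂cubeMeasure d
      ≤ ∫⁻ x, ENNReal.ofReal (8 * c ^ 6 * h) * (1 + ‖v x‖ₑ ^ 4) ∂cubeMeasure d := by
        refine lintegral_mono_ae ?_
        filter_upwards [ae_restrict_mem (measurableSet_cube d)] with x hxc
        rw [← ofReal_norm, ← ofReal_norm, ← ENNReal.ofReal_pow (norm_nonneg _),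
          ← ENNReal.ofReal_pow (norm_nonneg _), ← ENNReal.ofReal_one,
          ← ENNReal.ofReal_add zero_le_one (by positivity), ← ENNReal.ofReal_mul (by positivity)]
        refine ENNReal.ofReal_le_ofReal ?_
        -- Convexity of the fourth power: (a + b)⁴ ≤ 2³ (a⁴ + b⁴).
        have h4 : (1 + |v x|) ^ 4 ≤ 8 * (1 + |v x| ^ 4) := by
          have h := add_pow_le (zero_le_one' ℝ) (abs_nonneg (v x)) 4
          norm_num at h
          linarith
        calc ‖fdCoeff g v h x - milCoeff g v x‖ ^ 2
            ≤ (√h * c ^ 3 * (1 + |v x|) ^ 2) ^ 2 := pow_le_pow_left₀ (norm_nonneg _)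
              (abs_fdCoeff_sub_milCoeff_le hg hg0 hg1 hg2 hc v hh hxc) 2
          _ = c ^ 6 * h * (1 + |v x|) ^ 4 := by
              rw [mul_pow, mul_pow, Real.sq_sqrt hh.le]
              ring
          _ ≤ c ^ 6 * h * (8 * (1 + |v x| ^ 4)) := by gcongr
          _ = _ := by rw [Real.norm_eq_abs]; ring
    _ = ENNReal.ofReal (8 * c ^ 6 * h)
          * (cubeMeasure d univ + ∫⁻ x, ‖v x‖ₑ ^ 4 ∂cubeMeasure d) := by
        rw [lintegral_const_mul' _ _ ENNReal.ofReal_ne_top, lintegral_add_left measurable_const,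
          lintegral_const, one_mul]
    _ ≤ _ := by
        rw [ENNReal.ofReal_mul (q := _ + N) (by positivity), ENNReal.ofReal_add (by positivity) hN,
          ofReal_measureReal]
        gcongr

end Estimates

end ParabolicSPDE

end

theorem mainTheorem2
    (d : ℕ) (hd1 : 1 ≤ d) (hd3 : d ≤ 3) (k T c ρ : ℝ) (hk : 0 < k) (hT : 0 < T) (hc : 0 < c)
    (hρ0 : 0 < ρ) (hρ1 : ρ < 1)
    -- the covariance operator: symmetric, nonnegative, with an orthonormal eigenbasis, trace class
    (Q : HSp d →L[ℝ] HSp d) (hQ : Q.IsPositive)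
    {J : Type*} [Countable J] (η : HilbertBasis J ℝ (HSp d)) (μ : J → ℝ)
    (hη : ∀ j, Q (η j) = μ j • η j) (htr : Summable μ)
    -- the eigenfunctions are continuous, uniformly bounded, with summable weighted Hölder norms
    (φ : J → EuclideanSpace ℝ (Fin d) → ℝ) (hφ : ∀ j, ContinuousOn (φ j) (cube d))
    (hηφ : ∀ j, η j =ᵐ[cubeMeasure d] φ j)
    (hsup : ⨆ j, cNorm d (φ j) ≤ ENNReal.ofReal c)
    (hhol : ∑' j, ENNReal.ofReal (μ j) * holderNorm d ρ (φ j) ^ 2 ≤ ENNReal.ofReal c)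
    -- the coefficient `g`
    (g : EuclideanSpace ℝ (Fin d) → ℝ → ℝ)
    (hg : ContDiffOn ℝ 2 (fun p : EuclideanSpace ℝ (Fin d) × ℝ => g p.1 p.2) (cube d ×ˢ univ))
    (hg0 : ∀ x ∈ cube d, |g x 0| ≤ c)
    (hg1 : ∀ x ∈ cube d, ∀ y : ℝ, |deriv (g x) y| ≤ c)
    (hg2 : ∀ x ∈ cube d, ∀ y : ℝ, |iteratedDeriv 2 (g x) y| ≤ c)
    (hgx : ∀ x ∈ cube d, ∀ y : ℝ, ‖fderiv ℝ (fun z => g z y) x‖ ≤ c) :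
    -- for `v ∈ V_β` the bilinear operators are well defined on `U₀ × U₀` and Hilbert–Schmidt
    (∀ h : ℝ, 0 < h → h ≤ T → ∀ v ∈ VSet d k ((d : ℝ) / 5),
      (∀ u w : U0 Q,
        (GG Q g v h u w =ᵐ[cubeMeasure d] fun x =>
          1 / Real.sqrt h * (g x (v x + Real.sqrt h * g x (v x)) - g x (v x))
            * U0.incl Q u x * U0.incl Q w x) ∧
        (GpG Q g v u w =ᵐ[cubeMeasure d] fun x =>
          deriv (g x) (v x) * g x (v x) * U0.incl Q u x * U0.incl Q w x)) ∧
      IsHS2 (GG Q g v h) ∧ IsHS2 (GpG Q g v) ∧ IsHS2 (GG1 Q g v h)) ∧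
    -- the two estimates, with a constant independent of `h`, `v` and `w`
    ∃ C₀ : ℝ, 0 < C₀ ∧ ∀ h : ℝ, 0 < h → h ≤ T →
      (∀ v ∈ VSet d k ((d : ℝ) / 5), ∀ w ∈ VSet d k ((d : ℝ) / 5),
        hs2NormSq (GG Q g v h - GG Q g w h) ≤ ENNReal.ofReal (C₀ / h * ‖v - w‖ ^ 2)) ∧
      (∀ v ∈ VSet d k ((d : ℝ) / 5),
        hs2NormSq (GG1 Q g v h)
          ≤ ENNReal.ofReal (C₀ * h * (1 + VNorm d k ((d : ℝ) / 5) v ^ 4))) := by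
  have hc0 := hc.le
  obtain ⟨K, hKc, hK⟩ := exists_evaluation_vector (ρ := ρ) η hQ hη hηφ hc0 hhol
  have hGG : ∀ h : ℝ, 0 < h → ∀ (v : HSp d) (u w : U0 Q), GG Q g v h u w
      =ᵐ[cubeMeasure d] fun x => fdCoeff g v h x * U0.incl Q u x * U0.incl Q w x :=
    fun h hh v => bilinMul_ae hKc hK (memLp_fdCoeff hg hg0 hg1 hc0 v hh)
  have hGpG : ∀ (v : HSp d) (u w : U0 Q), GpG Q g v u w
      =ᵐ[cubeMeasure d] fun x => milCoeff g v x * U0.incl Q u x * U0.incl Q w x :=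
    fun v => bilinMul_ae hKc hK (memLp_milCoeff hg hg0 hg1 hc0 v)
  have hGG1 : ∀ h : ℝ, 0 < h → ∀ (v : HSp d) (u w : U0 Q), GG1 Q g v h u w
      =ᵐ[cubeMeasure d] fun x =>
        (fdCoeff g v h x - milCoeff g v x) * U0.incl Q u x * U0.incl Q w x := fun h hh v u w => by
    filter_upwards [hGG h hh v u w, hGpG v u w,
      Lp.coeFn_sub (GG Q g v h u w) (GpG Q g v u w)] with x h1 h2 h3
    rw [GG1, h3, Pi.sub_apply, h1, h2]
    ring
  have hGGsub : ∀ h : ℝ, 0 < h → ∀ (v w : HSp d) (u u' : U0 Q),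
      (GG Q g v h - GG Q g w h) u u' =ᵐ[cubeMeasure d] fun x =>
        (fdCoeff g v h x - fdCoeff g w h x) * U0.incl Q u x * U0.incl Q u' x :=
    fun h hh v w u u' => by
      filter_upwards [hGG h hh v u u', hGG h hh w u u',
        Lp.coeFn_sub (GG Q g v h u u') (GG Q g w h u u')] with x h1 h2 h3
      rw [Pi.sub_apply, Pi.sub_apply, h3, Pi.sub_apply, h1, h2]
      ring
  refine ⟨fun h hh _ v _ => ⟨fun u w => ⟨hGG h hh v u w, hGpG v u w⟩,
    isHS2_of_ae_eq_mul hKc hK (memLp_fdCoeff hg hg0 hg1 hc0 v hh) (hGG h hh v),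
    isHS2_of_ae_eq_mul hKc hK (memLp_milCoeff hg hg0 hg1 hc0 v) (hGpG v),
    isHS2_of_ae_eq_mul hKc hK ((memLp_fdCoeff hg hg0 hg1 hc0 v hh).sub
      (memLp_milCoeff hg hg0 hg1 hc0 v)) (hGG1 h hh v)⟩, ?_⟩
  obtain ⟨M, hM0, hM⟩ := exists_lintegral_pow_four_le hd1 hk
  set V := (cubeMeasure d).real Set.univ with hV
  have hV0 : 0 ≤ V := measureReal_nonneg
  -- In both constants c² is the Hilbert–Schmidt factor of multiplication operators. The rest is the
  -- Lipschitz constant in C₁, and the Taylor constant with the cube's volume V and the embedding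
  -- constant M in C₂. Their sum serves both estimates.
  set C₁ := c ^ 2 * (c * (2 + √T * c)) ^ 2 with hC₁
  set C₂ := c ^ 2 * (8 * c ^ 6 * (V + M)) with hC₂
  have hC₁0 : 0 < C₁ := by positivity
  have hC₂0 : 0 ≤ C₂ := by positivity
  refine ⟨C₁ + C₂, by positivity, fun h hh hhT => ⟨fun v _ w _ => ?_, fun v hv => ?_⟩⟩
  · refine (hs2NormSq_le_of_ae_eq_mul hKc hK (hGGsub h hh v w)).trans ?_
    refine (mul_le_mul_right (lintegral_fdCoeff_sub_le hg hg1 hc0 v w hh hhT) _).trans ?_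
    rw [← ENNReal.ofReal_pow hc0, ← ENNReal.ofReal_mul (by positivity)]
    refine ENNReal.ofReal_le_ofReal ?_
    calc c ^ 2 * ((c * (2 + √T * c)) ^ 2 / h * ‖v - w‖ ^ 2) = C₁ / h * ‖v - w‖ ^ 2 := by
          rw [hC₁]; ring
      _ ≤ _ := by gcongr; linarith
  · have hN : 0 ≤ VNorm d k ((d : ℝ) / 5) v ^ 4 := by positivity
    refine (hs2NormSq_le_of_ae_eq_mul hKc hK (hGG1 h hh v)).trans ?_
    refine (mul_le_mul_right (lintegral_fdCoeff_sub_milCoeff_le hg hg0 hg1 hg2 hc0 hh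
      (mul_nonneg hM0 hN) (hM v hv)) _).trans ?_
    rw [← ENNReal.ofReal_pow hc0, ← ENNReal.ofReal_mul (by positivity)]
    refine ENNReal.ofReal_le_ofReal ?_
    calc c ^ 2 * (8 * c ^ 6 * h * (V + M * VNorm d k ((d : ℝ) / 5) v ^ 4))
        ≤ c ^ 2 * (8 * c ^ 6 * h * ((V + M) * (1 + VNorm d k ((d : ℝ) / 5) v ^ 4))) := by
          gcongr
          nlinarith [mul_nonneg hV0 hN]
      _ = C₂ * h * (1 + VNorm d k ((d : ℝ) / 5) v ^ 4) := by rw [hC₂]; ring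
      _ ≤ _ := by gcongr; linarith
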